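/- Let $d\ge 1$ be an integer and $n>0$. Write $B(x,r)$ for the closed ball in $\mathbb R^d$ and $\operatorname{spt}\mu$ for the support of a positive Radon measure $\mu$. Let $\mu$ and $\nu$ be positive Radon measures on $\mathbb R^d$ with compact support such that: - $\mu$ is $n$-Ahlfors–David regular: there is $c_\mu>0$ with $c_\mu^{-1}r^n\le \mu(B(x,r))\le c_\mu r^n$ for all $x\in\operatorname{spt}\mu$ and all $0<r\le \operatorname{diam}(\operatorname{spt}\mu)$; - $\nu$ has $n$-growth: there is $c_\nu>0$ with $\nu(B(x,r))\le c_\nu r^n$ for all $x\in\mathbb R^d$ and $r>0$. Let $k:\{(x,y)\in\mathbb R^d\times\mathbb R^d: x\ne y\}\to\mathbb C$ be an $n$-dimensional Calderón–Zygmund kernel, that is, there are $c>0$ and $0<\eta\le1$ such that for all $x\neq y$ $$|k(x,y)|\le \frac{c}{|x-y|^{n}},\qquad |k(x,y)-k(x',y)|+|k(y,x)-k(y,x')|\le \frac{c\,|x-x'|^{\eta}}{|x-y|^{n+\eta}}\quad\text{if } |x-x'|\le \tfrac12|x-y|.$$ For $\varepsilon>0$, a finite complex Radon measure $\sigma$ and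 a function $f$ put $$T^k_\varepsilon\sigma(x)=\int_{|x-y|>\varepsilon}k(x,y)\,d\sigma(y),\qquad T^k_{\mu,\varepsilon}f(x)=\int_{|x-y|>\varepsilon}k(x,y)f(y)\,d\mu(y),\qquad x\in\mathbb R^d .$$ Suppose that $T^k_\mu$ is bounded on $L^2(\mu)$, i.e. there is $C_0$ with $\|T^k_{\mu,\varepsilon}f\|_{L^2(\mu)}\le C_0\|f\|_{L^2(\mu)}$ for all $f\in L^2(\mu)$ and all $\varepsilon>0$. Then $T^k$ is bounded from $M(\operatorname{spt}\mu)$, the space of finite complex Radon measures $\sigma$ in $\operatorname{spt}\mu$ with the total variation norm $\|\sigma\|$, to $L^{1,\infty}(\nu)$: there is a constant $C$ such that $$\nu\{x\in\mathbb R^d: |T^k_\varepsilon\sigma(x)|>\lambda\}\le \frac{C\,\|\sigma\|}{\lambda}\qquad\text{for all }\sigma\in M(\operatorname{spt}\mu),\ \lambda>0,\ \varepsilon>0 .$$ In particular $T^k_\mu$ is bounded from $L^1(\mu)$ to $L^{1,\infty}(\nu)$: there is a constant $C$ such that $$\nu\{x\in\mathbb R^d: |T^k_{\mu,\varepsilon}f(x)|>\lambda\}\le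 \frac{C}{\lambda}\,\|f\|_{L^1(\mu)}\qquad\text{for all } f\in L^1(\mu),\ \lambda>0,\ \varepsilon>0 .$$ -/

import Mathlib

open MeasureTheory
open scoped ENNReal NNReal

namespace CZ

/-- `μ` has `n`-growth: `μ(B(x,r)) ≤ c rⁿ` for all points `x` and all radii `r > 0`. -/
def HasGrowth {d : ℕ} (n : ℝ) (μ : Measure (EuclideanSpace ℝ (Fin d))) : Prop :=
  ∃ c : ℝ, 0 < c ∧ ∀ (x : EuclideanSpace ℝ (Fin d)) (r : ℝ), 0 < r →
    μ (Metric.closedBall x r) ≤ ENNReal.ofReal (c * r ^ n)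

/-- `μ` is `n`-Ahlfors-David regular: `c⁻¹ rⁿ ≤ μ(B(x,r)) ≤ c rⁿ` for all `x ∈ spt μ` and all
`0 < r ≤ diam (spt μ)` (the diameter is taken in `[0,∞]`). -/
def IsADRegular {d : ℕ} (n : ℝ) (μ : Measure (EuclideanSpace ℝ (Fin d))) : Prop :=
  ∃ c : ℝ, 0 < c ∧ ∀ x ∈ μ.support, ∀ r : ℝ, 0 < r →
    ENNReal.ofReal r ≤ Metric.ediam μ.support →
      ENNReal.ofReal (c⁻¹ * r ^ n) ≤ μ (Metric.closedBall x r) ∧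
        μ (Metric.closedBall x r) ≤ ENNReal.ofReal (c * r ^ n)

/-- `k` is an `n`-dimensional Calderón-Zygmund kernel. The kernel is a complex function of pairs
of distinct points; the values of the total function `k` on the diagonal play no role. -/
def IsCZKernel {d : ℕ} (n : ℝ)
    (k : EuclideanSpace ℝ (Fin d) → EuclideanSpace ℝ (Fin d) → ℂ) : Prop :=
  ∃ c η : ℝ, 0 < c ∧ 0 < η ∧ η ≤ 1 ∧ ∀ x y : EuclideanSpace ℝ (Fin d), x ≠ y →
    ‖k x y‖ ≤ c / dist x y ^ n ∧
      ∀ x' : EuclideanSpace ℝ (Fin d), dist x x' ≤ dist x y / 2 →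
        ‖k x y - k x' y‖ + ‖k y x - k y x'‖ ≤ c * dist x x' ^ η / dist x y ^ (n + η)

/-- The space `M(U)` of finite complex (Radon) measures in `U`: the complex Borel measures whose
total variation measure vanishes outside `U`. -/
def finiteComplexMeasures {d : ℕ} (U : Set (EuclideanSpace ℝ (Fin d))) :
    Set (ComplexMeasure (EuclideanSpace ℝ (Fin d))) :=
  {σ | σ.variation Uᶜ = 0}

/-- The truncated operator on complex measures,
`T_ε σ (x) = ∫_{|x - y| > ε} k(x,y) dσ(y)`. -/
noncomputable def truncMeasure {d : ℕ}
    (k : EuclideanSpace ℝ (Fin d) → EuclideanSpace ℝ (Fin d) → ℂ) (ε : ℝ)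
    (σ : ComplexMeasure (EuclideanSpace ℝ (Fin d))) (x : EuclideanSpace ℝ (Fin d)) : ℂ :=
  ∫ᵛ y in {y | ε < dist x y}, k x y ∂[ContinuousLinearMap.mul ℝ ℂ; σ]

/-- The truncated operator on functions,
`T_{μ,ε} f (x) = ∫_{|x - y| > ε} k(x,y) f(y) dμ(y)`. -/
noncomputable def truncFun {d : ℕ}
    (k : EuclideanSpace ℝ (Fin d) → EuclideanSpace ℝ (Fin d) → ℂ)
    (μ : Measure (EuclideanSpace ℝ (Fin d))) (ε : ℝ)
    (f : EuclideanSpace ℝ (Fin d) → ℂ) (x : EuclideanSpace ℝ (Fin d)) : ℂ :=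
  ∫ y in {y | ε < dist x y}, k x y * f y ∂μ

/-- `T_μ` is bounded on `L²(μ)`: the truncations `T_{μ,ε}` are bounded on `L²(μ)`, uniformly in
`ε > 0`. -/
def IsBoundedL2 {d : ℕ} (k : EuclideanSpace ℝ (Fin d) → EuclideanSpace ℝ (Fin d) → ℂ)
    (μ : Measure (EuclideanSpace ℝ (Fin d))) : Prop :=
  ∃ C : ℝ≥0, ∀ ε : ℝ, 0 < ε → ∀ f : EuclideanSpace ℝ (Fin d) → ℂ, MemLp f 2 μ →
    eLpNorm (truncFun k μ ε f) 2 μ ≤ C * eLpNorm f 2 μ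

/-- `T` is bounded from `M(U)` to `L^{1,∞}(ν)`: for some constant `C`,
`ν {|T_ε σ| > t} ≤ C ‖σ‖ / t` for all `σ ∈ M(U)`, `t > 0` and `ε > 0`, where `‖σ‖ = |σ|(U)`. -/
def IsBoundedMeasureWeakL1 {d : ℕ}
    (k : EuclideanSpace ℝ (Fin d) → EuclideanSpace ℝ (Fin d) → ℂ)
    (U : Set (EuclideanSpace ℝ (Fin d))) (ν : Measure (EuclideanSpace ℝ (Fin d))) : Prop :=
  ∃ C : ℝ≥0, ∀ ε : ℝ, 0 < ε → ∀ σ ∈ finiteComplexMeasures U, ∀ t : ℝ, 0 < t →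
    ν {x | t < ‖truncMeasure k ε σ x‖} ≤ C * σ.variation U / ENNReal.ofReal t

/-- `T_μ` is bounded from `L¹(μ)` to `L^{1,∞}(ν)`: for some constant `C`,
`ν {|T_{μ,ε} f| > t} ≤ C ‖f‖_{L¹(μ)} / t` for all `f ∈ L¹(μ)`, `t > 0` and `ε > 0`. -/
def IsBoundedL1WeakL1 {d : ℕ}
    (k : EuclideanSpace ℝ (Fin d) → EuclideanSpace ℝ (Fin d) → ℂ)
    (μ ν : Measure (EuclideanSpace ℝ (Fin d))) : Prop :=
  ∃ C : ℝ≥0, ∀ ε : ℝ, 0 < ε → ∀ f : EuclideanSpace ℝ (Fin d) → ℂ, MemLp f 1 μ →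
    ∀ t : ℝ, 0 < t →
      ν {x | t < ‖truncFun k μ ε f x‖} ≤ C * eLpNorm f 1 μ / ENNReal.ofReal t

end CZ

/-! The difficulty is that the $L^2$ bound lives on $\mu$ while the level sets are measured by
$\nu$, which may be carried far from or across $\operatorname{spt}\mu$ and is unrelated to $\mu$.
The operator is therefore transferred from $\mu$ to $\nu$ by comparing its values at nearby points,
and only then extended to singular measures by a Calderón–Zygmund decomposition.

Transfer: let $m\le\Lambda\mu$ and let $|T_\varepsilon m(x)|$ exceed a large multiple of $\Lambda$.
With $r=\max(\varepsilon,\operatorname{dist}(x,\operatorname{spt}\mu))$ the values of $T_\varepsilon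
m$ at $x$ and at points of a ball of radius $r$ centred on the support differ by $O(\Lambda)$ plus
the operator applied to a local piece of $m$ (`KernelBounds.enorm_truncOp_le`). The local piece is
controlled in mean square by the $L^2$ bound, so $\Lambda^2r^n\lesssim\int_{B(x,2r)}|T_\varepsilon
m|^2\,d\mu$ (`KernelBounds.energy_le`). Growth of $\nu$ and a Vitali covering sum these into
$\nu\{|T_\varepsilon m|>G\Lambda\}\lesssim\Lambda^{-2}\|T_\varepsilon m\|_{L^2(\mu)}^2\lesssim
m(\mathbb R^d)/\Lambda$ (`KernelBounds.measure_truncOp_le_of_le_smul`).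

Decomposition: a positive measure $\sigma$ on the support is cut at height $\lambda$ along balls
where its density first drops back below $\lambda$. The pieces of $\sigma$ there are replaced by
multiples of $\mu$ of equal mass (`exists_calderonZygmund_decomposition`). The new measure has
density $O(\lambda)$ and falls under the transfer estimate. The difference has mean zero on each
ball, so kernel regularity makes its image integrable against $\nu$ off enlarged balls; the enlarged
balls have small $\nu$ measure by growth (`KernelBounds.measure_truncOp_le_of_small`). The sharp
truncation spoils regularity only within $2\varepsilon$ of a centre, which growth absorbs.

Very heavy $\sigma$ and a one-point support are handled directly
(`KernelBounds.exists_measure_truncOp_le`). Complex measures and functions split into four positive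
parts. -/

namespace CZ

open Set Metric

/-! ### Covering arguments and comparison of measures -/

section Covering

variable {X : Type*} [MetricSpace X] [SecondCountableTopology X]

/-- Vitali covering lemma: a family of balls of bounded radii, one for each point of `E`, has a
countable disjoint subfamily whose fivefold enlargements cover `E`. -/
theorem exists_countable_disjoint_cover (E : Set X) (r : X → ℝ) (R : ℝ)
    (hr : ∀ x ∈ E, 0 < r x ∧ r x ≤ R) :
    ∃ u ⊆ E, u.Countable ∧ (u.PairwiseDisjoint fun x => closedBall x (r x)) ∧
      E ⊆ ⋃ x ∈ u, closedBall x (5 * r x) := by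
  obtain ⟨u, huE, hdisj, hcov⟩ :=
    Vitali.exists_disjoint_subfamily_covering_enlargement_closedBall E id r R
      (fun a ha => (hr a ha).2) 5 (by norm_num)
  refine ⟨u, huE, ?_, hdisj, fun x hx => ?_⟩
  · refine hdisj.countable_of_nonempty_interior fun x hx => ⟨x, ?_⟩
    exact ball_subset_interior_closedBall (mem_ball_self (hr x (huE hx)).1)
  · obtain ⟨b, hb, hsub⟩ := hcov x hx
    exact mem_biUnion hb (hsub (mem_closedBall_self (hr x hx).1.le))

/-- A countable family of measurable sets can be shrunk to a disjoint family with the same union. -/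
theorem exists_disjoint_refinement {ι X : Type*} [Countable ι] [MeasurableSpace X] (W : ι → Set X)
    (hW : ∀ i, MeasurableSet (W i)) :
    ∃ V : ι → Set X, (∀ i, V i ⊆ W i) ∧ (∀ i, MeasurableSet (V i)) ∧
      Pairwise (Function.onFun Disjoint V) ∧ ⋃ i, V i = ⋃ i, W i := by
  obtain ⟨e, he⟩ := exists_injective_nat ι
  refine ⟨fun i => W i \ ⋃ j ∈ {j | e j < e i}, W j, fun i => sdiff_subset, fun i => ?_, ?_, ?_⟩
  · exact (hW i).diff (MeasurableSet.biUnion (to_countable _) fun j _ => hW j)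
  · have key : ∀ i j, e i < e j → Disjoint (W i \ ⋃ l ∈ {l | e l < e i}, W l)
        (W j \ ⋃ l ∈ {l | e l < e j}, W l) := fun i j hij =>
      Set.disjoint_left.2 fun x hx hx' => hx'.2 (mem_biUnion (show i ∈ {l | e l < e j} from hij) hx.1)
    intro i j hij
    rcases lt_or_gt_of_ne (fun h => hij (he h)) with h | h
    · exact key i j h
    · exact (key j i h).symm
  · refine subset_antisymm (iUnion_mono fun i => sdiff_subset) fun x hx => ?_
    have hex : ∃ m, ∃ i, e i = m ∧ x ∈ W i := by
      obtain ⟨i, hi⟩ := mem_iUnion.1 hx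
      exact ⟨e i, i, rfl, hi⟩
    classical
    obtain ⟨i, hi, hxi⟩ := Nat.find_spec hex
    refine mem_iUnion.2 ⟨i, hxi, fun hx' => ?_⟩
    obtain ⟨j, hj, hxj⟩ := mem_iUnion₂.1 hx'
    exact Nat.find_min hex (hi ▸ hj) ⟨j, rfl, hxj⟩

variable [MeasurableSpace X] [BorelSpace X]

/-- The fivefold balls of a Vitali subfamily cover `E`, while the original balls are disjoint and
stay in `U`. It serves both to differentiate measures (`U` shrinking to `E`) and to sum local
energies (`U` the whole space). -/
theorem measure_le_of_closedBall_le (σ m : Measure X) (K : ℝ≥0∞) (E U : Set X) (r : X → ℝ) (R : ℝ)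
    (hr : ∀ x ∈ E, 0 < r x ∧ r x ≤ R) (hU : ∀ x ∈ E, closedBall x (r x) ⊆ U)
    (h : ∀ x ∈ E, σ (closedBall x (5 * r x)) ≤ K * m (closedBall x (r x))) :
    σ E ≤ K * m U := by
  obtain ⟨u, huE, hcount, hdisj, hcov⟩ := exists_countable_disjoint_cover E r R hr
  calc σ E ≤ σ (⋃ x ∈ u, closedBall x (5 * r x)) := measure_mono hcov
    _ ≤ ∑' x : u, σ (closedBall (x : X) (5 * r x)) := measure_biUnion_le σ hcount _
    _ ≤ ∑' x : u, K * m (closedBall (x : X) (r x)) :=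
        ENNReal.tsum_le_tsum fun x => h x (huE x.2)
    _ = K * m (⋃ x ∈ u, closedBall x (r x)) := by
        rw [ENNReal.tsum_mul_left,
          measure_biUnion hcount hdisj fun x _ => measurableSet_closedBall]
    _ ≤ K * m U := by
        gcongr
        exact iUnion₂_subset fun x hx => hU x (huE hx)

theorem ofReal_mul_rpow {a r n : ℝ} (ha : 0 ≤ a) (hn : 0 ≤ n) :
    ENNReal.ofReal (a * r) ^ n = ENNReal.ofReal a ^ n * ENNReal.ofReal r ^ n := by
  rw [ENNReal.ofReal_mul ha, ENNReal.mul_rpow_of_nonneg _ _ hn]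

/-- An upper density bound for `σ` and a lower one for `μ` give domination on every subset: cover by
balls inside an open set of nearly the same `μ` measure. Neither absolute continuity nor
measurability of `A` is needed. -/
theorem measure_le_of_subset_of_closedBall_le (σ μ : Measure X) [IsFiniteMeasure μ] {n : ℝ} (hn : 0 < n)
    (lam B : ℝ≥0) (R : ℝ) (hR : 0 < R) (G : Set X)
    (hσ : ∀ x ∈ G, ∀ s : ℝ, 0 < s → σ (closedBall x s) ≤ lam * ENNReal.ofReal s ^ n)
    (hμ : ∀ x ∈ G, ∀ s : ℝ, 0 < s → s ≤ R → ENNReal.ofReal s ^ n ≤ B * μ (closedBall x s))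
    (A : Set X) (hA : A ⊆ G) :
    σ A ≤ lam * ENNReal.ofReal 5 ^ n * B * μ A := by
  have hK : (lam * ENNReal.ofReal 5 ^ n * B : ℝ≥0∞) ≠ ∞ := by finiteness
  refine le_of_forall_gt fun b hb => ?_
  by_cases hK0 : (lam * ENNReal.ofReal 5 ^ n * B : ℝ≥0∞) = 0
  -- With a zero constant, division by it is not available, but any finite-measure neighbourhood
  -- will do.
  · have := measure_le_of_closedBall_le σ μ (lam * ENNReal.ofReal 5 ^ n * B) A univ (fun _ => R) R
      (fun x _ => ⟨hR, le_rfl⟩) (fun x _ => subset_univ _) (fun x hx => ?_)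
    · refine this.trans_lt ?_
      rw [hK0, zero_mul] at hb ⊢
      exact hb
    · refine (hσ x (hA hx) _ (by positivity)).trans ?_
      rw [ofReal_mul_rpow (by norm_num) hn.le, mul_assoc _ (B : ℝ≥0∞), ← mul_assoc]
      gcongr
      exact hμ x (hA hx) R hR le_rfl
  · have hb' : μ A < b / (lam * ENNReal.ofReal 5 ^ n * B) := by
      rw [ENNReal.lt_div_iff_mul_lt (Or.inl hK0) (Or.inl hK), mul_comm]
      exact hb
    obtain ⟨U, hAU, hUo, hUb⟩ := A.exists_isOpen_lt_of_lt _ hb'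
    have hex : ∀ x : X, ∃ r : ℝ, x ∈ A → (0 < r ∧ r ≤ R) ∧ closedBall x r ⊆ U := by
      intro x
      by_cases hx : x ∈ A
      · obtain ⟨r, hr, hrU⟩ := Metric.nhds_basis_closedBall.mem_iff.1 (hUo.mem_nhds (hAU hx))
        exact ⟨min r R, fun _ => ⟨⟨lt_min hr hR, min_le_right _ _⟩,
          (closedBall_subset_closedBall (min_le_left _ _)).trans hrU⟩⟩
      · exact ⟨0, fun h => absurd h hx⟩
    choose r hr using hex
    refine (measure_le_of_closedBall_le σ μ (lam * ENNReal.ofReal 5 ^ n * B) A U r R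
      (fun x hx => (hr x hx).1) (fun x hx => (hr x hx).2) (fun x hx => ?_)).trans_lt ?_
    · refine (hσ x (hA hx) _ (by have := (hr x hx).1.1; positivity)).trans ?_
      rw [ofReal_mul_rpow (by norm_num) hn.le, mul_assoc _ (B : ℝ≥0∞), ← mul_assoc]
      gcongr
      exact hμ x (hA hx) _ (hr x hx).1.1 (hr x hx).1.2
    · rw [mul_comm]
      exact (ENNReal.lt_div_iff_mul_lt (Or.inl hK0) (Or.inl hK)).1 hUb

end Covering

/-! ### Dyadic summation -/

section Dyadic

variable {X : Type*} [PseudoMetricSpace X] [SecondCountableTopology X] [MeasurableSpace X]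
  [OpensMeasurableSpace X]

/-- The constant `2 ^ n * ∑ j, 2 ^ (-j η)`. -/
noncomputable def dyadicConst (n η : ℝ) : ℝ≥0 :=
  Real.toNNReal (2 ^ n * (1 - 2 ^ (-η))⁻¹)

/-- The annulus $2^j\rho\le|y-a|<2^{j+1}\rho$ contributes at most $A\,2^n2^{-j\eta}$, a geometric
series. Growth is used only at radii at least `ρ`. -/
theorem lintegral_rpow_div_le (m : Measure X) {n η : ℝ} (hn : 0 < n) (hη : 0 < η) (A : ℝ≥0∞)
    (a : X) {ρ : ℝ} (hρ : 0 < ρ)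
    (hm : ∀ s : ℝ, ρ ≤ s → m (closedBall a s) ≤ A * ENNReal.ofReal s ^ n) :
    ∫⁻ y in {y | ρ ≤ dist y a}, ENNReal.ofReal (ρ ^ η / dist y a ^ (n + η)) ∂m ≤
      A * dyadicConst n η := by
  set g : ℕ → X → ℝ≥0∞ := fun j => (closedBall a (2 ^ (j + 1) * ρ)).indicator
    fun _ => ENNReal.ofReal (ρ ^ η / (2 ^ j * ρ) ^ (n + η)) with hg
  have hmeas : MeasurableSet {y | ρ ≤ dist y a} :=
    measurableSet_le measurable_const (measurable_id.dist measurable_const)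
  have h2 : (0 : ℝ) < 1 - 2 ^ (-η) := by
    have : (2 : ℝ) ^ (-η) < 1 := Real.rpow_lt_one_of_one_lt_of_neg (by norm_num) (by linarith)
    linarith
  have hterm : ∀ j : ℕ, ENNReal.ofReal (ρ ^ η / (2 ^ j * ρ) ^ (n + η)) *
      m (closedBall a (2 ^ (j + 1) * ρ)) ≤ A * ENNReal.ofReal (2 ^ n * ((2 : ℝ) ^ (-η)) ^ j) := by
    intro j
    have hle : ρ ≤ 2 ^ (j + 1) * ρ := by
      have : (1 : ℝ) ≤ 2 ^ (j + 1) := one_le_pow₀ (by norm_num)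
      nlinarith
    refine (mul_le_mul_right (hm _ hle) _).trans ?_
    rw [mul_left_comm, ENNReal.ofReal_rpow_of_pos (by positivity),
      ← ENNReal.ofReal_mul (by positivity)]
    refine mul_le_mul' le_rfl (ENNReal.ofReal_le_ofReal (le_of_eq ?_))
    have e1 : (2 : ℝ) ^ (j + 1) * ρ = 2 * (2 ^ j * ρ) := by ring
    have e2 : ((2 : ℝ) ^ (-η)) ^ j = ((2 : ℝ) ^ j) ^ (-η) := by
      rw [← Real.rpow_natCast, ← Real.rpow_mul (by norm_num), ← Real.rpow_natCast,
        ← Real.rpow_mul (by norm_num), mul_comm]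
    rw [e1, e2]
    have hq : (0 : ℝ) < 2 ^ j := by positivity
    generalize (2 : ℝ) ^ j = q at hq
    rw [Real.mul_rpow (x := 2) (y := q * ρ) (by norm_num) (by positivity),
      Real.rpow_add (by positivity), Real.mul_rpow (x := q) (y := ρ) (z := η) hq.le hρ.le,
      Real.rpow_neg hq.le]
    field_simp
  calc ∫⁻ y in {y | ρ ≤ dist y a}, ENNReal.ofReal (ρ ^ η / dist y a ^ (n + η)) ∂m
      ≤ ∫⁻ y in {y | ρ ≤ dist y a}, ∑' j, g j y ∂m := by
        refine setLIntegral_mono' hmeas fun y hy => ?_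
        have hy' : ρ ≤ dist y a := hy
        obtain ⟨j, hj1, hj2⟩ := exists_nat_pow_near (x := dist y a / ρ) (y := 2)
          ((one_le_div hρ).2 hy') (by norm_num)
        rw [le_div_iff₀ hρ] at hj1
        rw [div_lt_iff₀ hρ] at hj2
        refine le_trans ?_ (ENNReal.le_tsum j)
        rw [hg]
        simp only
        rw [indicator_of_mem (mem_closedBall.2 hj2.le)]
        gcongr
    _ ≤ ∫⁻ y, ∑' j, g j y ∂m := setLIntegral_le_lintegral _ _
    _ = ∑' j, ∫⁻ y, g j y ∂m := lintegral_tsum fun j =>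
        (measurable_const.indicator measurableSet_closedBall).aemeasurable
    _ ≤ ∑' j, A * ENNReal.ofReal (2 ^ n * ((2 : ℝ) ^ (-η)) ^ j) := by
        refine ENNReal.tsum_le_tsum fun j => ?_
        rw [hg]
        simp only
        rw [lintegral_indicator measurableSet_closedBall, setLIntegral_const]
        exact hterm j
    _ = A * dyadicConst n η := by
        rw [ENNReal.tsum_mul_left, ← ENNReal.ofReal_tsum_of_nonneg (fun j => by positivity)
          ((summable_geometric_of_lt_one (by positivity) (by linarith)).mul_left _),
          tsum_mul_left, tsum_geometric_of_lt_one (by positivity) (by linarith)]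
        rfl

end Dyadic

/-! ### Calderón–Zygmund kernels and their truncations -/

section Kernel

variable {d : ℕ}

local notation "𝔼" => EuclideanSpace ℝ (Fin d)

/-- The bounds defining a Calderón-Zygmund kernel, with explicit constants. -/
structure KernelBounds (n c η : ℝ) (k : 𝔼 → 𝔼 → ℂ) : Prop where
  c_pos : 0 < c
  η_pos : 0 < η
  size : ∀ x y, x ≠ y → ‖k x y‖ ≤ c / dist x y ^ n
  left : ∀ x y x', x ≠ y → dist x x' ≤ dist x y / 2 →
    ‖k x y - k x' y‖ ≤ c * dist x x' ^ η / dist x y ^ (n + η)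
  right : ∀ x y x', x ≠ y → dist x x' ≤ dist x y / 2 →
    ‖k y x - k y x'‖ ≤ c * dist x x' ^ η / dist x y ^ (n + η)

theorem IsCZKernel.exists_kernelBounds {n : ℝ} {k : 𝔼 → 𝔼 → ℂ} (hk : IsCZKernel n k) :
    ∃ c η, KernelBounds n c η k := by
  obtain ⟨c, η, hc, hη, -, h⟩ := hk
  exact ⟨c, η, hc, hη, fun x y hxy => (h x y hxy).1,
    fun x y x' hxy hx => (le_add_of_nonneg_right (norm_nonneg _)).trans ((h x y hxy).2 x' hx),
    fun x y x' hxy hx => (le_add_of_nonneg_left (norm_nonneg _)).trans ((h x y hxy).2 x' hx)⟩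

variable {n c η : ℝ} {k : EuclideanSpace ℝ (Fin d) → EuclideanSpace ℝ (Fin d) → ℂ}

/-- The kernel has no assumed measurability; joint continuity off the diagonal follows from the
Hölder bounds, changing one variable at a time, and supplies it. -/
theorem KernelBounds.continuousOn (hk : KernelBounds n c η k) :
    ContinuousOn (fun p : 𝔼 × 𝔼 => k p.1 p.2) {p | p.1 ≠ p.2} := by
  rintro ⟨x, y⟩ hxy
  refine ContinuousAt.continuousWithinAt ?_
  have hxy' : x ≠ y := hxy
  have hd : 0 < dist x y := dist_pos.2 hxy'
  rw [ContinuousAt, tendsto_iff_norm_sub_tendsto_zero]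
  have hη := hk.η_pos
  have hlim : Filter.Tendsto (fun p : 𝔼 × 𝔼 => c * dist x p.1 ^ η / dist x y ^ (n + η) +
      c * dist y p.2 ^ η / dist y p.1 ^ (n + η)) (nhds (x, y)) (nhds 0) := by
    have h1 : ContinuousAt (fun p : 𝔼 × 𝔼 => c * dist x p.1 ^ η / dist x y ^ (n + η) +
      c * dist y p.2 ^ η / dist y p.1 ^ (n + η)) (x, y) := by
      have a1 : ContinuousAt (fun p : 𝔼 × 𝔼 => dist x p.1 ^ η) (x, y) :=
        (continuous_const.dist continuous_fst).continuousAt.rpow_const (Or.inr hη.le)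
      have a2 : ContinuousAt (fun p : 𝔼 × 𝔼 => dist y p.2 ^ η) (x, y) :=
        (continuous_const.dist continuous_snd).continuousAt.rpow_const (Or.inr hη.le)
      have a3 : ContinuousAt (fun p : 𝔼 × 𝔼 => dist y p.1 ^ (n + η)) (x, y) :=
        (continuous_const.dist continuous_fst).continuousAt.rpow_const
          (Or.inl (by simpa [dist_comm] using hd.ne'))
      refine ((a1.const_mul c).div_const _).add ((a2.const_mul c).div a3 ?_)
      simp only
      rw [dist_comm]
      exact (Real.rpow_pos_of_pos hd _).ne'
    have h2 := h1.tendsto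
    simpa [Real.zero_rpow hη.ne'] using h2
  refine squeeze_zero' (Filter.Eventually.of_forall fun _ => norm_nonneg _) ?_ hlim
  have e1 : ∀ᶠ p : 𝔼 × 𝔼 in nhds (x, y), dist x p.1 < dist x y / 2 := by
    refine (continuous_const.dist continuous_fst).continuousAt.eventually_lt
      continuousAt_const ?_
    simpa using hd
  have e2 : ∀ᶠ p : 𝔼 × 𝔼 in nhds (x, y), dist y p.2 < dist y p.1 / 2 := by
    refine (continuous_const.dist continuous_snd).continuousAt.eventually_lt
      ((continuous_const.dist continuous_fst).div_const 2).continuousAt ?_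
    simpa [dist_comm] using hd
  filter_upwards [e1, e2] with p h1 h2
  have hp : y ≠ p.1 := by
    intro h
    rw [h, dist_self] at h2
    linarith [dist_nonneg (x := p.1) (y := p.2)]
  calc ‖k p.1 p.2 - k x y‖ = ‖(k x y - k p.1 y) + (k p.1 y - k p.1 p.2)‖ := by
        rw [norm_sub_rev]; congr 1; ring
    _ ≤ _ := (norm_add_le _ _).trans
        (add_le_add (hk.left x y p.1 hxy' h1.le) (hk.right y p.1 p.2 hp h2.le))

/-- The kernel `k` truncated to `{|x - y| > ε}`. -/
noncomputable def truncKernel (k : 𝔼 → 𝔼 → ℂ) (ε : ℝ) (x y : 𝔼) : ℂ :=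
  {y | ε < dist x y}.indicator (k x) y

theorem truncKernel_of_lt {ε : ℝ} {x y : 𝔼} (h : ε < dist x y) : truncKernel k ε x y = k x y :=
  indicator_of_mem (s := {y | ε < dist x y}) h _

theorem truncKernel_of_le {ε : ℝ} {x y : 𝔼} (h : dist x y ≤ ε) : truncKernel k ε x y = 0 :=
  indicator_of_notMem (s := {y | ε < dist x y}) (not_lt.2 h) _

theorem measurableSet_lt_dist (ε : ℝ) (x : 𝔼) : MeasurableSet {y | ε < dist x y} :=
  measurableSet_lt measurable_const (measurable_const.dist measurable_id)

theorem KernelBounds.measurable_truncKernel (hk : KernelBounds n c η k) {ε : ℝ} (hε : 0 < ε) :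
    Measurable fun p : 𝔼 × 𝔼 => truncKernel k ε p.1 p.2 := by
  have hs : MeasurableSet {p : 𝔼 × 𝔼 | ε < dist p.1 p.2} :=
    measurableSet_lt measurable_const (measurable_fst.dist measurable_snd)
  have h := ContinuousOn.measurable_piecewise (f := fun p : 𝔼 × 𝔼 => k p.1 p.2) (g := fun _ => 0)
    (s := {p : 𝔼 × 𝔼 | ε < dist p.1 p.2})
    (hk.continuousOn.mono fun p (hp : ε < dist p.1 p.2) => dist_pos.1 (hε.trans hp))
    continuousOn_const hs
  convert h using 2 with p
  by_cases hp : ε < dist p.1 p.2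
  · rw [truncKernel_of_lt hp]
    exact (if_pos hp).symm
  · rw [truncKernel_of_le (not_lt.1 hp)]
    exact (if_neg hp).symm

theorem KernelBounds.norm_truncKernel_le (hk : KernelBounds n c η k) (hn : 0 < n) {ε s : ℝ}
    (hs : 0 < s) (x y : 𝔼) (h : ε < dist x y → s ≤ dist x y) :
    ‖truncKernel k ε x y‖ ≤ c / s ^ n := by
  have hc := hk.c_pos
  rcases le_or_gt (dist x y) ε with h' | h'
  · rw [truncKernel_of_le h', norm_zero]
    positivity
  · rw [truncKernel_of_lt h']
    have hd := h h'
    refine (hk.size x y (dist_pos.1 (hs.trans_le hd))).trans ?_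
    gcongr

theorem KernelBounds.norm_truncKernel_le_eps (hk : KernelBounds n c η k) (hn : 0 < n) {ε : ℝ}
    (hε : 0 < ε) (x y : 𝔼) : ‖truncKernel k ε x y‖ ≤ c / ε ^ n :=
  hk.norm_truncKernel_le hn hε x y fun h => h.le

theorem KernelBounds.integrable_truncKernel (hk : KernelBounds n c η k) (hn : 0 < n) {ε : ℝ}
    (hε : 0 < ε) (x : 𝔼) (σ : Measure 𝔼) [IsFiniteMeasure σ] :
    Integrable (truncKernel k ε x) σ :=
  Integrable.of_bound ((hk.measurable_truncKernel hε).comp measurable_prodMk_left).aestronglyMeasurable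
    (c / ε ^ n) (Filter.Eventually.of_forall fun y => hk.norm_truncKernel_le_eps hn hε x y)

/-- Regularity of the truncated kernel in the second variable: the discontinuity along the
truncation sphere only contributes when `|x - a| ≤ 2ε`. -/
theorem KernelBounds.norm_truncKernel_sub_le (hk : KernelBounds n c η k) (hn : 0 < n) {ε ρ : ℝ}
    (hε : 0 < ε) (hρ : 0 < ρ) (x y a : 𝔼) (hy : dist y a ≤ ρ) (hx : 2 * ρ ≤ dist x a) :
    ‖truncKernel k ε x y - truncKernel k ε x a‖ ≤ c * (ρ ^ η / dist x a ^ (n + η)) +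
      (closedBall a (2 * ε)).indicator (fun _ => c / ε ^ n) x := by
  have hc := hk.c_pos
  have hη := hk.η_pos
  have hxa : 0 < dist x a := by linarith
  have h1 : 0 ≤ c * (ρ ^ η / dist x a ^ (n + η)) := by positivity
  have h2 : 0 ≤ (closedBall a (2 * ε)).indicator (fun _ => c / ε ^ n) x :=
    indicator_nonneg (fun _ _ => by positivity) _
  have htri : dist x a ≤ dist x y + dist y a := dist_triangle _ _ _
  rcases le_or_gt (dist x y) ε with hxy | hxy
  -- Since $|y-a|\le\rho\le|x-a|/2$, the bound $|x-y|\le\varepsilon$ forces $|x-a|\le2\varepsilon$.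
  · rw [truncKernel_of_le hxy, zero_sub, norm_neg,
      indicator_of_mem (mem_closedBall.2 (by linarith))]
    linarith [hk.norm_truncKernel_le_eps hn hε x a]
  · rcases le_or_gt (dist x a) ε with hxa' | hxa'
    · rw [truncKernel_of_le hxa', sub_zero, indicator_of_mem (mem_closedBall.2 (by linarith))]
      linarith [hk.norm_truncKernel_le_eps hn hε x y]
    · rw [truncKernel_of_lt hxy, truncKernel_of_lt hxa', norm_sub_rev]
      have := hk.right a x y (dist_pos.1 (by rwa [dist_comm])) (by
        rw [dist_comm a y, dist_comm a x]; linarith)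
      rw [dist_comm a y, dist_comm a x] at this
      refine (this.trans ?_).trans (le_add_of_nonneg_right h2)
      rw [mul_div_assoc]
      gcongr

/-- The operator `T_ε` on positive measures. -/
noncomputable def truncOp (k : 𝔼 → 𝔼 → ℂ) (ε : ℝ) (σ : Measure 𝔼) (x : 𝔼) : ℂ :=
  ∫ y, truncKernel k ε x y ∂σ

theorem KernelBounds.measurable_truncOp (hk : KernelBounds n c η k) {ε : ℝ} (hε : 0 < ε)
    (σ : Measure 𝔼) [IsFiniteMeasure σ] : Measurable (truncOp k ε σ) :=
  ((hk.measurable_truncKernel hε).stronglyMeasurable.integral_prod_right').measurable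

/-- Cancellation: as the masses agree, the constant `z` may be subtracted from the integrand in both
integrals. -/
theorem enorm_integral_sub_le_of_univ_eq {X : Type*} [MeasurableSpace X] (p q : Measure X)
    [IsFiniteMeasure p] [IsFiniteMeasure q] (hpq : p univ = q univ) {φ : X → ℂ}
    (hp : Integrable φ p) (hq : Integrable φ q) (z : ℂ) (b : ℝ)
    (hpb : ∀ᵐ y ∂p, ‖φ y - z‖ ≤ b) (hqb : ∀ᵐ y ∂q, ‖φ y - z‖ ≤ b) :
    ‖∫ y, φ y ∂p - ∫ y, φ y ∂q‖ₑ ≤ 2 * p univ * ENNReal.ofReal b := by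
  have key : ∀ (m : Measure X) [IsFiniteMeasure m], Integrable φ m → (∀ᵐ y ∂m, ‖φ y - z‖ ≤ b) →
      ‖∫ y, φ y ∂m - m.real univ • z‖ₑ ≤ ENNReal.ofReal b * m univ := by
    intro m _ hm hmb
    rw [← integral_const, ← integral_sub hm (integrable_const z)]
    refine (enorm_integral_le_lintegral_enorm _).trans ?_
    rw [← lintegral_const]
    refine lintegral_mono_ae (hmb.mono fun y hy => ?_)
    rw [← ofReal_norm]
    exact ENNReal.ofReal_le_ofReal hy
  have hreal : p.real univ = q.real univ := by rw [measureReal_def, measureReal_def, hpq]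
  calc ‖∫ y, φ y ∂p - ∫ y, φ y ∂q‖ₑ
      = ‖(∫ y, φ y ∂p - p.real univ • z) - (∫ y, φ y ∂q - q.real univ • z)‖ₑ := by
        rw [hreal]; congr 1; ring
    _ ≤ ENNReal.ofReal b * p univ + ENNReal.ofReal b * q univ :=
        (enorm_sub_le).trans (add_le_add (key p hp hpb) (key q hq hqb))
    _ = 2 * p univ * ENNReal.ofReal b := by rw [← hpq]; ring

end Kernel

/-! ### Measures with bounded density: the quadratic bound and comparison of nearby values -/

section Good

variable {d : ℕ}

local notation "𝔼" => EuclideanSpace ℝ (Fin d)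

variable {n c η : ℝ} {k : EuclideanSpace ℝ (Fin d) → EuclideanSpace ℝ (Fin d) → ℂ}

theorem truncFun_eq_integral (μ : Measure 𝔼) (ε : ℝ) (f : 𝔼 → ℂ) (x : 𝔼) :
    truncFun k μ ε f x = ∫ y, truncKernel k ε x y * f y ∂μ := by
  rw [truncFun, ← integral_indicator (measurableSet_lt_dist ε x)]
  refine integral_congr_ae (Filter.Eventually.of_forall fun y => ?_)
  simp only [truncKernel, indicator]
  split_ifs <;> simp

theorem isFiniteMeasure_of_le_smul {X : Type*} [MeasurableSpace X] {m μ : Measure X}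
    [IsFiniteMeasure μ] {Λ : ℝ≥0} (hm : m ≤ Λ • μ) : IsFiniteMeasure m :=
  isFiniteMeasure_of_le _ hm

/-- The `L²` bound, rewritten for measures with bounded density. -/
theorem IsBoundedL2.exists_lintegral_truncOp_le {μ : Measure 𝔼} [IsFiniteMeasure μ]
    (hT : IsBoundedL2 k μ) :
    ∃ C : ℝ≥0, ∀ ε : ℝ, 0 < ε → ∀ (Λ : ℝ≥0) (m : Measure 𝔼), m ≤ Λ • μ →
      ∫⁻ x, ‖truncOp k ε m x‖ₑ ^ 2 ∂μ ≤ C * (Λ * m univ) := by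
  obtain ⟨C, hC⟩ := hT
  refine ⟨C ^ 2, fun ε hε Λ m hm => ?_⟩
  have : IsFiniteMeasure m := isFiniteMeasure_of_le_smul hm
  have : m.HaveLebesgueDecomposition μ := Measure.haveLebesgueDecomposition_of_sigmaFinite m μ
  have hac : m ≪ μ := Measure.absolutelyContinuous_of_le_smul hm
  set h := m.rnDeriv μ with hh
  have hmeas : Measurable h := Measure.measurable_rnDeriv _ _
  have hle : ∀ᵐ x ∂μ, h x ≤ Λ := by
    refine ae_le_of_forall_setLIntegral_le_of_sigmaFinite hmeas fun s hs _ => ?_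
    rw [setLIntegral_const]
    exact (Measure.setLIntegral_rnDeriv_le s).trans (hm s)
  set f : 𝔼 → ℂ := fun x => ((h x).toReal : ℂ) with hf
  have hfmeas : Measurable f := Complex.measurable_ofReal.comp hmeas.ennreal_toReal
  have hfh : ∀ᵐ x ∂μ, ‖f x‖ₑ = h x := by
    filter_upwards [hle] with x hx
    rw [hf, ← ofReal_norm, Complex.norm_real, Real.norm_of_nonneg ENNReal.toReal_nonneg,
      ENNReal.ofReal_toReal (hx.trans_lt ENNReal.coe_lt_top).ne]
  have hLp : MemLp f 2 μ := by
    refine MemLp.of_bound hfmeas.aestronglyMeasurable Λ ?_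
    filter_upwards [hle] with x hx
    rw [hf, Complex.norm_real, Real.norm_of_nonneg ENNReal.toReal_nonneg]
    exact ENNReal.toReal_le_coe_of_le_coe hx
  have hop : truncOp k ε m = truncFun k μ ε f := by
    ext x
    rw [truncFun_eq_integral, truncOp, ← integral_rnDeriv_smul hac]
    refine integral_congr_ae (Filter.Eventually.of_forall fun y => ?_)
    simp only [hf, Complex.real_smul]
    rw [mul_comm]
  have sq : ∀ g : 𝔼 → ℂ, eLpNorm g 2 μ ^ 2 = ∫⁻ x, ‖g x‖ₑ ^ 2 ∂μ := by
    intro g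
    have := eLpNorm_nnreal_pow_eq_lintegral (f := g) (μ := μ) (p := 2) (by norm_num)
    simpa using this
  rw [← sq, hop]
  calc eLpNorm (truncFun k μ ε f) 2 μ ^ 2 ≤ (C * eLpNorm f 2 μ) ^ 2 := by
        gcongr
        exact hC ε hε f hLp
    _ = C ^ 2 * ∫⁻ x, ‖f x‖ₑ ^ 2 ∂μ := by rw [mul_pow, sq]
    -- The density satisfies $h^2\le\Lambda h$, which turns the $L^2$ norm into mass.
    _ ≤ C ^ 2 * ∫⁻ x, Λ * h x ∂μ := by
        refine mul_le_mul' le_rfl (lintegral_mono_ae ?_)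
        filter_upwards [hle, hfh] with x hx hx'
        rw [hx', pow_two]
        gcongr
    _ ≤ C ^ 2 * (Λ * m univ) := by
        rw [lintegral_const_mul _ hmeas]
        gcongr
        exact Measure.lintegral_rnDeriv_le
    _ = _ := by norm_cast

/-- The constant in the comparison of `T_ε m` at nearby points. -/
noncomputable def comparisonConst (n c η : ℝ) (A : ℝ≥0) : ℝ≥0 :=
  A * (Real.toNNReal (c * 4 ^ n) + Real.toNNReal c * dyadicConst n η)

/-- Split at $B(x,4r)$. The near part at `x` is bounded by size and growth, because `hr` keeps the
visible mass at distance at least `r`. The far parts at `x` and `x'` differ by a regularity term.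
The near part at `x'` has no pointwise bound and stays on the right, to be averaged. -/
theorem KernelBounds.enorm_truncOp_le (hk : KernelBounds n c η k) (hn : 0 < n) {ε r : ℝ}
    (hε : 0 < ε) (hεr : ε ≤ r) (m : Measure 𝔼) [IsFiniteMeasure m] (A : ℝ≥0)
    (hm : ∀ (x : 𝔼) (s : ℝ), 0 < s → m (closedBall x s) ≤ A * ENNReal.ofReal s ^ n)
    (x x' : 𝔼) (hxx' : dist x x' ≤ 2 * r) (hr : ∀ᵐ y ∂m, ε < dist x y → r ≤ dist x y) :
    ‖truncOp k ε m x‖ₑ ≤ comparisonConst n c η A + ‖truncOp k ε m x'‖ₑ +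
      ‖truncOp k ε (m.restrict (closedBall x (4 * r))) x'‖ₑ := by
  have hc := hk.c_pos
  have hη := hk.η_pos
  have hr0 : 0 < r := hε.trans_le hεr
  set W := closedBall x (4 * r) with hW
  have hWm : MeasurableSet W := measurableSet_closedBall
  have split : ∀ z, truncOp k ε m z =
      ∫ y in W, truncKernel k ε z y ∂m + ∫ y in Wᶜ, truncKernel k ε z y ∂m := fun z =>
    (integral_add_compl hWm (hk.integrable_truncKernel hn hε z m)).symm
  have near : ‖∫ y in W, truncKernel k ε x y ∂m‖ₑ ≤ A * Real.toNNReal (c * 4 ^ n) := by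
    calc ‖∫ y in W, truncKernel k ε x y ∂m‖ₑ ≤ ∫⁻ y in W, ‖truncKernel k ε x y‖ₑ ∂m :=
          enorm_integral_le_lintegral_enorm _
      _ ≤ ∫⁻ y in W, ENNReal.ofReal (c / r ^ n) ∂m := by
          refine lintegral_mono_ae ((ae_restrict_of_ae hr).mono fun y hy => ?_)
          rw [← ofReal_norm]
          exact ENNReal.ofReal_le_ofReal (hk.norm_truncKernel_le hn hr0 x y hy)
      _ = ENNReal.ofReal (c / r ^ n) * m W := setLIntegral_const _ _
      _ ≤ ENNReal.ofReal (c / r ^ n) * (A * ENNReal.ofReal (4 * r) ^ n) := by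
          gcongr
          exact hm _ _ (by positivity)
      _ = A * ENNReal.ofReal (c * 4 ^ n) := by
          rw [mul_left_comm, ENNReal.ofReal_rpow_of_pos (by positivity),
            ← ENNReal.ofReal_mul (by positivity), Real.mul_rpow (by norm_num) hr0.le]
          congr 2
          have : 0 < r ^ n := by positivity
          field_simp
  have far : ‖∫ y in Wᶜ, truncKernel k ε x y ∂m - ∫ y in Wᶜ, truncKernel k ε x' y ∂m‖ₑ ≤
      A * (Real.toNNReal c * dyadicConst n η) := by
    rw [← integral_sub (hk.integrable_truncKernel hn hε x _)
      (hk.integrable_truncKernel hn hε x' _)]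
    calc ‖∫ y in Wᶜ, (truncKernel k ε x y - truncKernel k ε x' y) ∂m‖ₑ
        ≤ ∫⁻ y in Wᶜ, ‖truncKernel k ε x y - truncKernel k ε x' y‖ₑ ∂m :=
          enorm_integral_le_lintegral_enorm _
      _ ≤ ∫⁻ y in Wᶜ, ENNReal.ofReal c *
            ENNReal.ofReal ((2 * r) ^ η / dist y x ^ (n + η)) ∂m := by
          refine setLIntegral_mono' hWm.compl fun y hy => ?_
          have hy' : 4 * r < dist y x := by simpa [hW] using hy
          have hyx : 4 * r < dist x y := by rwa [dist_comm]
          -- Both points see `y` beyond the truncation, since $|x'-y|>4r-2r\ge\varepsilon$; moreover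
          -- $|x-x'|\le2r\le|x-y|/2$, so kernel regularity applies.
          have hyx' : ε < dist x' y := by
            have := dist_triangle x x' y
            linarith
          rw [truncKernel_of_lt (by linarith), truncKernel_of_lt hyx', ← ofReal_norm,
            ← ENNReal.ofReal_mul hc.le]
          refine ENNReal.ofReal_le_ofReal ((hk.left x y x' (dist_pos.1 (by linarith))
            (by linarith)).trans ?_)
          rw [mul_div_assoc, dist_comm y x]
          gcongr
      _ ≤ ∫⁻ y in {y | 2 * r ≤ dist y x}, ENNReal.ofReal c *
            ENNReal.ofReal ((2 * r) ^ η / dist y x ^ (n + η)) ∂m := by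
          refine lintegral_mono_set fun y hy => ?_
          have hy' : 4 * r < dist y x := by simpa [hW] using hy
          show 2 * r ≤ dist y x
          linarith
      _ = ENNReal.ofReal c * ∫⁻ y in {y | 2 * r ≤ dist y x},
            ENNReal.ofReal ((2 * r) ^ η / dist y x ^ (n + η)) ∂m :=
          lintegral_const_mul' _ _ ENNReal.ofReal_ne_top
      _ ≤ ENNReal.ofReal c * (A * dyadicConst n η) := by
          gcongr
          exact lintegral_rpow_div_le m hn hη A x (by positivity)
            fun s hs => hm x s (by linarith)
      _ = A * (Real.toNNReal c * dyadicConst n η) := by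
          rw [mul_left_comm]; rfl
  have e : truncOp k ε m x = (∫ y in W, truncKernel k ε x y ∂m) +
      (∫ y in Wᶜ, truncKernel k ε x y ∂m - ∫ y in Wᶜ, truncKernel k ε x' y ∂m) +
      truncOp k ε m x' - truncOp k ε (m.restrict W) x' := by
    rw [split x, split x', truncOp]
    ring
  rw [e]
  refine enorm_sub_le.trans ?_
  gcongr
  refine (enorm_add_le _ _).trans ?_
  gcongr
  refine (enorm_add_le _ _).trans ?_
  rw [comparisonConst]
  push_cast
  rw [mul_add]
  exact add_le_add near far

theorem add_add_sq_le (a b e : ℝ≥0∞) : (a + b + e) ^ 2 ≤ 9 * a ^ 2 + 9 * b ^ 2 + 9 * e ^ 2 := by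
  have key : ∀ z : ℝ≥0∞, a ≤ z → b ≤ z → e ≤ z → (a + b + e) ^ 2 ≤ 9 * z ^ 2 := by
    intro z ha hb he
    calc (a + b + e) ^ 2 ≤ (z + z + z) ^ 2 := by gcongr
      _ = 9 * z ^ 2 := by ring
  rcases le_total a b with h1 | h1 <;> rcases le_total b e with h2 | h2 <;>
    rcases le_total a e with h3 | h3
  · exact (key e h3 h2 le_rfl).trans le_add_self
  · exact (key e (h1.trans h2) h2 le_rfl).trans le_add_self
  · exact (key b h1 le_rfl h2).trans (le_add_self.trans le_self_add)
  · exact (key b h1 le_rfl h2).trans (le_add_self.trans le_self_add)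
  · exact (key e h3 h2 le_rfl).trans le_add_self
  · exact (key a le_rfl h1 h3).trans (le_self_add.trans le_self_add)
  · exact (key a le_rfl h1 (h2.trans h1)).trans (le_self_add.trans le_self_add)
  · exact (key a le_rfl h1 h3).trans (le_self_add.trans le_self_add)

end Good

/-! ### Transfer to `ν` for measures with bounded density -/

section Good

variable {d : ℕ}

local notation "𝔼" => EuclideanSpace ℝ (Fin d)

variable {n c η : ℝ} {k : EuclideanSpace ℝ (Fin d) → EuclideanSpace ℝ (Fin d) → ℂ}

/-- The threshold constant for the operator on measures with bounded density. -/
noncomputable def goodConst (n c η : ℝ) (A B C : ℝ≥0) : ℝ≥0 :=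
  9 * comparisonConst n c η A ^ 2 + 9 * (C * A * (4 : ℝ≥0) ^ n * B) + 1

theorem comparisonConst_mul (n c η : ℝ) (Λ A : ℝ≥0) :
    comparisonConst n c η (Λ * A) = Λ * comparisonConst n c η A := by
  simp only [comparisonConst, mul_assoc]

theorem coe_ofNat_rpow {n : ℝ} (hn : 0 ≤ n) (q : ℝ≥0) :
    ((q ^ n : ℝ≥0) : ℝ≥0∞) = ENNReal.ofReal q ^ n := by
  rw [ENNReal.coe_rpow_of_nonneg _ hn, ENNReal.ofReal_coe_nnreal]

/-- Square the pointwise comparison and integrate it over $B(z,r)$, whose `μ` measure is at least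
$r^n/B$. The constant and local terms are then multiples of $\Lambda^2\mu(B(z,r))$ that the
threshold exceeds, so the energy of `truncOp k ε m` must make up the rest. -/
theorem KernelBounds.energy_le (hk : KernelBounds n c η k) (hn : 0 < n) {μ : Measure 𝔼}
    [IsFiniteMeasure μ] {A B C : ℝ≥0}
    (hA : ∀ (x : 𝔼) (s : ℝ), 0 < s → μ (closedBall x s) ≤ A * ENNReal.ofReal s ^ n) {ε r : ℝ}
    (hε : 0 < ε) (hεr : ε ≤ r)
    (hC : ∀ (Λ : ℝ≥0) (m : Measure 𝔼), m ≤ Λ • μ →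
      ∫⁻ x, ‖truncOp k ε m x‖ₑ ^ 2 ∂μ ≤ C * (Λ * m univ))
    {Λ : ℝ≥0} {m : Measure 𝔼} (hm : m ≤ Λ • μ) (x z : 𝔼) (hxz : dist x z ≤ r)
    (hB : ENNReal.ofReal r ^ n ≤ B * μ (closedBall z r))
    (hr : ∀ᵐ y ∂μ, ε < dist x y → r ≤ dist x y)
    (hx : goodConst n c η A B C * Λ < ‖truncOp k ε m x‖ₑ) :
    Λ ^ 2 * ENNReal.ofReal r ^ n ≤
      9 * B * ∫⁻ y in closedBall x (2 * r), ‖truncOp k ε m y‖ₑ ^ 2 ∂μ := by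
  have : IsFiniteMeasure m := isFiniteMeasure_of_le_smul hm
  have hr0 : 0 < r := hε.trans_le hεr
  set D := comparisonConst n c η A with hD
  set K := goodConst n c η A B C with hK
  set W := closedBall z r with hW
  have hWsub : W ⊆ closedBall x (2 * r) := fun y hy => by
    rw [hW, mem_closedBall] at hy
    rw [mem_closedBall]
    have := dist_triangle y z x
    rw [dist_comm z x] at this
    linarith
  have hmA : ∀ (x : 𝔼) (s : ℝ), 0 < s →
      m (closedBall x s) ≤ (Λ * A : ℝ≥0) * ENNReal.ofReal s ^ n := by
    intro y s hs
    refine (hm _).trans ?_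
    rw [Measure.smul_apply, ENNReal.smul_def, smul_eq_mul, ENNReal.coe_mul, mul_assoc]
    gcongr
    exact hA y s hs
  have hac : m ≪ μ := Measure.absolutelyContinuous_of_le_smul hm
  set H := truncOp k ε (m.restrict (closedBall x (4 * r))) with hH
  set F := truncOp k ε m with hF
  have hFm : Measurable fun y => ‖F y‖ₑ ^ 2 := (hk.measurable_truncOp hε m).enorm.pow_const 2
  have hpt : ∀ y ∈ W, ‖F x‖ₑ ^ 2 ≤ 9 * (Λ * D) ^ 2 + 9 * ‖F y‖ₑ ^ 2 + 9 * ‖H y‖ₑ ^ 2 := by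
    intro y hy
    have := hk.enorm_truncOp_le hn hε hεr m (Λ * A) hmA x y
      (by simpa [dist_comm] using hWsub hy) (hac.ae_le hr)
    rw [comparisonConst_mul, ENNReal.coe_mul] at this
    exact (pow_le_pow_left' this 2).trans (add_add_sq_le _ _ _)
  have hint : ‖F x‖ₑ ^ 2 * μ W ≤ 9 * (Λ * D) ^ 2 * μ W + 9 * ∫⁻ y in W, ‖F y‖ₑ ^ 2 ∂μ +
      9 * ∫⁻ y in W, ‖H y‖ₑ ^ 2 ∂μ := by
    have hsum : Measurable fun y => 9 * ((Λ : ℝ≥0∞) * D) ^ 2 + 9 * ‖F y‖ₑ ^ 2 :=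
      measurable_const.add (hFm.const_mul _)
    rw [← setLIntegral_const, ← setLIntegral_const, ← lintegral_const_mul _ hFm,
      ← lintegral_const_mul' _ _ (by norm_num), ← lintegral_add_left measurable_const,
      ← lintegral_add_left hsum]
    exact setLIntegral_mono' measurableSet_closedBall hpt
  -- The restricted measure still has density at most `Λ`, and its mass is at most $\Lambda
  -- A(4r)^n$.
  have hHle : ∫⁻ y in W, ‖H y‖ₑ ^ 2 ∂μ ≤ C * A * ((4 : ℝ≥0) ^ n : ℝ≥0) * B * (Λ ^ 2 * μ W) := by
    calc ∫⁻ y in W, ‖H y‖ₑ ^ 2 ∂μ ≤ ∫⁻ y, ‖H y‖ₑ ^ 2 ∂μ := setLIntegral_le_lintegral _ _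
      _ ≤ C * (Λ * m.restrict (closedBall x (4 * r)) univ) :=
          hC Λ _ (Measure.restrict_le_self.trans hm)
      _ ≤ C * (Λ * ((Λ * A : ℝ≥0) * ENNReal.ofReal (4 * r) ^ n)) := by
          rw [Measure.restrict_apply_univ]
          gcongr
          exact hmA x _ (by positivity)
      _ = C * A * ((4 : ℝ≥0) ^ n : ℝ≥0) * Λ ^ 2 * ENNReal.ofReal r ^ n := by
          rw [ofReal_mul_rpow (by norm_num) hn.le, coe_ofNat_rpow hn.le]
          push_cast
          ring
      _ ≤ C * A * ((4 : ℝ≥0) ^ n : ℝ≥0) * Λ ^ 2 * (B * μ W) := by gcongr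
      _ = _ := by ring
  have hlow : K * Λ ^ 2 * μ W ≤ ‖F x‖ₑ ^ 2 * μ W := by
    gcongr
    calc (K : ℝ≥0∞) * Λ ^ 2 ≤ (K : ℝ≥0∞) ^ 2 * Λ ^ 2 := by
          gcongr
          have : (1 : ℝ≥0) ≤ K := le_add_self
          exact_mod_cast le_self_pow₀ this (by norm_num)
      _ = ((K : ℝ≥0∞) * Λ) ^ 2 := by ring
      _ ≤ ‖F x‖ₑ ^ 2 := by gcongr
  -- The first two summands of `goodConst` cancel the constant and local terms; its final `1` is
  -- what survives on the left. Cancellation is legitimate because the terms are finite.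
  have hcomb : (Λ : ℝ≥0∞) ^ 2 * μ W ≤ 9 * ∫⁻ y in W, ‖F y‖ₑ ^ 2 ∂μ := by
    have hfin : (9 * (D : ℝ≥0∞) ^ 2 + 9 * (C * A * ((4 : ℝ≥0) ^ n : ℝ≥0) * B)) *
        (Λ ^ 2 * μ W) ≠ ∞ := by finiteness
    rw [← ENNReal.add_le_add_iff_left hfin]
    calc _ = K * Λ ^ 2 * μ W := by
          rw [hK, goodConst]
          push_cast
          ring
      _ ≤ _ := hlow.trans hint
      _ ≤ 9 * (Λ * D) ^ 2 * μ W + 9 * ∫⁻ y in W, ‖F y‖ₑ ^ 2 ∂μ +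
          9 * (C * A * ((4 : ℝ≥0) ^ n : ℝ≥0) * B * (Λ ^ 2 * μ W)) := by gcongr
      _ = _ := by ring
  calc (Λ : ℝ≥0∞) ^ 2 * ENNReal.ofReal r ^ n ≤ Λ ^ 2 * (B * μ W) := by gcongr
    _ = B * (Λ ^ 2 * μ W) := by ring
    _ ≤ B * (9 * ∫⁻ y in W, ‖F y‖ₑ ^ 2 ∂μ) := by gcongr
    _ ≤ B * (9 * ∫⁻ y in closedBall x (2 * r), ‖F y‖ₑ ^ 2 ∂μ) := by
        gcongr
    _ = _ := by ring

/-- Weak type estimate into `ν` for measures with bounded density with respect to `μ`. -/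
theorem KernelBounds.measure_truncOp_le_of_le_smul (hk : KernelBounds n c η k) (hn : 0 < n)
    {μ ν : Measure 𝔼} [IsFiniteMeasure μ] {S Z : Set 𝔼} (hS : IsCompact S) (hS0 : S.Nonempty)
    (hμS : μ Sᶜ = 0) (hνZ : ν Zᶜ = 0) {A A' B C : ℝ≥0} {R : ℝ}
    (hR : ∀ x ∈ Z, ∀ y ∈ S, dist x y ≤ R)
    (hA : ∀ (x : 𝔼) (s : ℝ), 0 < s → μ (closedBall x s) ≤ A * ENNReal.ofReal s ^ n)
    (hν : ∀ (x : 𝔼) (s : ℝ), 0 < s → ν (closedBall x s) ≤ A' * ENNReal.ofReal s ^ n)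
    (hB : ∀ x ∈ S, ∀ s : ℝ, 0 < s → s ≤ R → ENNReal.ofReal s ^ n ≤ B * μ (closedBall x s))
    {ε : ℝ} (hε : 0 < ε)
    (hC : ∀ (Λ : ℝ≥0) (m : Measure 𝔼), m ≤ Λ • μ →
      ∫⁻ x, ‖truncOp k ε m x‖ₑ ^ 2 ∂μ ≤ C * (Λ * m univ))
    {Λ : ℝ≥0} (hΛ : 0 < Λ) {m : Measure 𝔼} (hm : m ≤ Λ • μ) :
    ν {x | goodConst n c η A B C * Λ < ‖truncOp k ε m x‖ₑ} ≤
      (9 * A' * (10 : ℝ≥0) ^ n * B * C : ℝ≥0) * m univ / Λ := by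
  have : IsFiniteMeasure m := isFiniteMeasure_of_le_smul hm
  have hac : m ≪ μ := Measure.absolutelyContinuous_of_le_smul hm
  set F := truncOp k ε m with hF
  set K := goodConst n c η A B C
  have hFm : Measurable fun y => ‖F y‖ₑ ^ 2 := (hk.measurable_truncOp hε m).enorm.pow_const 2
  have hSae : ∀ᵐ y ∂μ, y ∈ S := by rwa [ae_iff]
  set E := {x | K * Λ < ‖F x‖ₑ} ∩ Z with hE
  have hΛ0 : (Λ : ℝ≥0∞) ≠ 0 := by exact_mod_cast hΛ.ne'
  have hνE : ν {x | K * Λ < ‖F x‖ₑ} ≤ ν E := by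
    have h : {x | K * Λ < ‖F x‖ₑ} ⊆ E ∪ Zᶜ := fun x hx => by
      by_cases hxZ : x ∈ Z
      · exact Or.inl ⟨hx, hxZ⟩
      · exact Or.inr hxZ
    refine (measure_mono h).trans ((measure_union_le _ _).trans ?_)
    rw [hνZ, add_zero]
  refine hνE.trans ?_
  -- The least radius at least `ε` for which the nearest support point is within `r x`; support
  -- points beyond the truncation are then at distance at least `r x`.
  set r : 𝔼 → ℝ := fun x => max ε (infDist x S) with hr
  have hr0 : ∀ x, 0 < r x := fun x => hε.trans_le (le_max_left _ _)
  have hrR : ∀ x ∈ E, r x ≤ R := by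
    intro x hx
    obtain ⟨y, hy⟩ := hS0
    refine max_le ?_ ((infDist_le_dist_of_mem hy).trans (hR x hx.2 y hy))
    -- If `ε` exceeded `R`, the truncation would remove all of `S` and the operator would vanish at
    -- `x`.
    by_contra! hlt
    have h0 : F x = 0 := by
      rw [hF, truncOp]
      have hSm : ∀ᵐ y ∂m, y ∈ S := hac.ae_le hSae
      refine integral_eq_zero_of_ae (hSm.mono fun y hy => ?_)
      exact truncKernel_of_le ((hR x hx.2 y hy).trans hlt.le)
    have hx1 : K * Λ < ‖F x‖ₑ := hx.1
    rw [h0, enorm_zero] at hx1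
    exact not_lt_bot hx1
  set mΦ := μ.withDensity fun y => ‖F y‖ₑ ^ 2 with hmΦ
  set K₂ : ℝ≥0∞ := (9 * A' * (10 : ℝ≥0) ^ n * B : ℝ≥0) / Λ ^ 2 with hK₂
  have hmain : ν E ≤ K₂ * mΦ univ := by
    refine measure_le_of_closedBall_le ν mΦ K₂ E univ (fun x => 2 * r x) (2 * R)
      (fun x hx => ⟨by have := hr0 x; positivity, by linarith [hrR x hx]⟩)
      (fun _ _ => subset_univ _) fun x hx => ?_
    obtain ⟨z, hzS, hz⟩ := hS.exists_infDist_eq_dist hS0 x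
    have hen := hk.energy_le hn hA hε (le_max_left ε (infDist x S)) hC hm x z
      (hz ▸ le_max_right _ _) (hB z hzS _ (hr0 x) (hrR x hx))
      (hSae.mono fun y hy hlt => max_le hlt.le (infDist_le_dist_of_mem hy)) hx.1
    rw [hmΦ, withDensity_apply _ measurableSet_closedBall]
    calc ν (closedBall x (5 * (2 * r x))) ≤ A' * ENNReal.ofReal (10 * r x) ^ n := by
          rw [show 5 * (2 * r x) = 10 * r x by ring]
          exact hν x _ (by have := hr0 x; positivity)
      _ = A' * ((10 : ℝ≥0) ^ n : ℝ≥0) * ENNReal.ofReal (r x) ^ n := by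
          rw [ofReal_mul_rpow (by norm_num) hn.le, coe_ofNat_rpow hn.le, mul_assoc]
          rfl
      _ ≤ A' * ((10 : ℝ≥0) ^ n : ℝ≥0) * (9 * B * (∫⁻ y in closedBall x (2 * r x),
            ‖F y‖ₑ ^ 2 ∂μ) / Λ ^ 2) := by
          gcongr
          rw [ENNReal.le_div_iff_mul_le (Or.inl (pow_ne_zero 2 hΛ0)) (Or.inl (by finiteness)),
            mul_comm]
          exact hen
      _ = _ := by
          rw [hK₂]
          simp only [div_eq_mul_inv]
          push_cast
          ring
  refine hmain.trans ?_
  rw [hmΦ, withDensity_apply _ MeasurableSet.univ, Measure.restrict_univ]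
  calc K₂ * ∫⁻ y, ‖F y‖ₑ ^ 2 ∂μ ≤ K₂ * (C * (Λ * m univ)) := by
        gcongr
        exact hC Λ m hm
    _ = (9 * A' * (10 : ℝ≥0) ^ n * B * C : ℝ≥0) * m univ *
          ((Λ : ℝ≥0∞) * ((Λ : ℝ≥0∞) ^ 2)⁻¹) := by
        rw [hK₂]
        simp only [div_eq_mul_inv]
        push_cast
        ring
    _ = _ := by
        rw [div_eq_mul_inv]
        congr 1
        rw [pow_two, ENNReal.mul_inv (Or.inl hΛ0) (Or.inl ENNReal.coe_ne_top), ← mul_assoc,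
          ENNReal.mul_inv_cancel hΛ0 ENNReal.coe_ne_top, one_mul]

end Good

/-! ### Calderón–Zygmund decomposition -/

section Decomposition

variable {X : Type*} [MetricSpace X] [MeasurableSpace X]

/-- A radius at which the density of `σ` exceeds `lam`, while at five times that radius it does
not. -/
theorem exists_stopping_radius (σ : Measure X) [IsFiniteMeasure σ] {n : ℝ} (hn : 0 < n) {lam : ℝ≥0}
    (hlam : 0 < lam) {x : X}
    (hx : ∃ s : ℝ, 0 < s ∧ lam * ENNReal.ofReal s ^ n < σ (closedBall x s)) :
    ∃ r : ℝ, 0 < r ∧ lam * ENNReal.ofReal r ^ n < σ (closedBall x r) ∧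
      σ (closedBall x (5 * r)) ≤ lam * ENNReal.ofReal (5 * r) ^ n := by
  obtain ⟨s, hs, hsx⟩ := hx
  by_contra! hcon
  -- Without a stopping radius the density stays above `lam` at all scales $5^js$, which a finite
  -- total mass forbids.
  have hall : ∀ j : ℕ, lam * ENNReal.ofReal (5 ^ j * s) ^ n < σ (closedBall x (5 ^ j * s)) := by
    intro j
    induction j with
    | zero => simpa using hsx
    | succ j ih =>
      have := hcon (5 ^ j * s) (by positivity) ih
      rwa [← mul_assoc, ← pow_succ'] at this
  have hlam0 : (lam : ℝ≥0∞) ≠ 0 := by exact_mod_cast hlam.ne'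
  set M : ℝ≥0∞ := (σ univ / lam) ^ n⁻¹ with hM
  have hMtop : M ≠ ∞ := by
    refine ENNReal.rpow_ne_top_of_nonneg (by positivity) ?_
    exact ENNReal.div_ne_top (measure_ne_top _ _) hlam0
  have hlt : ∀ j : ℕ, ENNReal.ofReal (5 ^ j * s) < M := by
    intro j
    rw [hM, ENNReal.lt_rpow_inv_iff hn, ENNReal.lt_div_iff_mul_lt (Or.inl hlam0)
      (Or.inl ENNReal.coe_ne_top), mul_comm]
    exact (hall j).trans_le (measure_mono (subset_univ _))
  obtain ⟨j, hj⟩ := pow_unbounded_of_one_lt (M.toReal / s) (by norm_num : (1 : ℝ) < 5)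
  rw [div_lt_iff₀ hs] at hj
  exact absurd ((ENNReal.ofReal_lt_iff_lt_toReal (by positivity) hMtop).1 (hlt j)) (not_lt.2 hj.le)

variable [SecondCountableTopology X] [BorelSpace X]

/-- Calderón-Zygmund decomposition of a finite measure `σ` on `S` at height `lam`, relative to a
measure `μ` that is lower regular on `S`: the parts `p i` of `σ` are replaced by multiples `q i`
of `μ` of the same mass, so that the resulting measure has density at most `2 * 5 ^ n * B * lam`. -/
theorem exists_calderonZygmund_decomposition (σ μ : Measure X) [IsFiniteMeasure σ]
    [IsFiniteMeasure μ] {n : ℝ} (hn : 0 < n) {S : Set X} (hσS : σ Sᶜ = 0) {lam B : ℝ≥0}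
    (hlam : 0 < lam) {R : ℝ} (hR : 0 < R)
    (hB : ∀ x ∈ S, ∀ s : ℝ, 0 < s → s ≤ R → ENNReal.ofReal s ^ n ≤ B * μ (closedBall x s))
    (hσ : σ univ < lam * ENNReal.ofReal R ^ n) :
    ∃ (u : Set X) (r : X → ℝ) (τ : Measure X) (p q : u → Measure X), u.Countable ∧
      (∀ i ∈ u, 0 < r i) ∧ σ = τ + Measure.sum p ∧
      τ + Measure.sum q ≤ (2 * (lam * (5 : ℝ≥0) ^ n * B)) • μ ∧
      (∀ i, p i univ = q i univ) ∧
      (∀ i : u, p i (closedBall (i : X) (5 * r i))ᶜ = 0) ∧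
      (∀ i : u, q i (closedBall (i : X) (5 * r i))ᶜ = 0) ∧
      lam * ∑' i : u, ENNReal.ofReal (r i) ^ n ≤ σ univ := by
  set E := {x ∈ S | ∃ s : ℝ, 0 < s ∧ lam * ENNReal.ofReal s ^ n < σ (closedBall x s)} with hE
  have hlam0 : (lam : ℝ≥0∞) ≠ 0 := by exact_mod_cast hlam.ne'
  have hex : ∀ x : X, ∃ r : ℝ, x ∈ E → 0 < r ∧ lam * ENNReal.ofReal r ^ n < σ (closedBall x r) ∧
      σ (closedBall x (5 * r)) ≤ lam * ENNReal.ofReal (5 * r) ^ n := by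
    intro x
    by_cases hx : x ∈ E
    · obtain ⟨r, hr⟩ := exists_stopping_radius σ hn hlam hx.2
      exact ⟨r, fun _ => hr⟩
    · exact ⟨0, fun h => absurd h hx⟩
  choose r hr using hex
  -- Smallness of the total mass keeps the stopping radii in the range where `μ` is lower regular.
  have hrR : ∀ x ∈ E, r x ≤ R := by
    intro x hx
    by_contra! hlt
    have h1 : lam * ENNReal.ofReal R ^ n ≤ lam * ENNReal.ofReal (r x) ^ n := by gcongr
    exact absurd ((hr x hx).2.1.trans_le (measure_mono (subset_univ _)))
      (not_lt.2 (hσ.le.trans h1))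
  obtain ⟨u, huE, hcount, hdisj, hcov⟩ := exists_countable_disjoint_cover E r R
    fun x hx => ⟨(hr x hx).1, hrR x hx⟩
  have : Countable u := hcount.to_subtype
  -- The fivefold balls may overlap, so `σ` is divided among disjoint pieces `V i`. The replacements
  -- are spread over the small balls `W i`, which are already disjoint, so their densities do not
  -- accumulate.
  obtain ⟨V, hVsub, hVm, hVdisj, hVU⟩ := exists_disjoint_refinement
    (fun i : u => closedBall (i : X) (5 * r i)) fun i => measurableSet_closedBall
  set W : u → Set X := fun i => closedBall (i : X) (r i) with hW
  have hWdisj : Pairwise (Function.onFun Disjoint W) := fun i j hij =>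
    hdisj i.2 j.2 fun h => hij (Subtype.ext h)
  have hWm : ∀ i, MeasurableSet (W i) := fun i => measurableSet_closedBall
  have hrpos : ∀ i : u, 0 < r i := fun i => (hr i (huE i.2)).1
  have hBW : ∀ i : u, ENNReal.ofReal (r i) ^ n ≤ B * μ (W i) := fun i =>
    hB i (huE i.2).1 _ (hrpos i) (hrR i (huE i.2))
  have hW0 : ∀ i, μ (W i) ≠ 0 := by
    intro i h0
    have h1 := hBW i
    rw [h0, mul_zero] at h1
    have h2 : 0 < ENNReal.ofReal (r i) ^ n :=
      ENNReal.rpow_pos (ENNReal.ofReal_pos.2 (hrpos i)) ENNReal.ofReal_ne_top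
    exact absurd h1 (not_le.2 h2)
  set K : ℝ≥0 := lam * (5 : ℝ≥0) ^ n * B with hK
  have hKc : (K : ℝ≥0∞) = lam * ENNReal.ofReal 5 ^ n * B := by
    rw [hK, ENNReal.coe_mul, ENNReal.coe_mul, coe_ofNat_rpow hn.le]
    rfl
  have hVK : ∀ i, σ (V i) ≤ K * μ (W i) := by
    intro i
    calc σ (V i) ≤ σ (closedBall (i : X) (5 * r i)) := measure_mono (hVsub i)
      _ ≤ lam * ENNReal.ofReal (5 * r i) ^ n := (hr i (huE i.2)).2.2
      _ = lam * ENNReal.ofReal 5 ^ n * ENNReal.ofReal (r i) ^ n := by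
          rw [ofReal_mul_rpow (by norm_num) hn.le, mul_assoc]
      _ ≤ lam * ENNReal.ofReal 5 ^ n * (B * μ (W i)) := by
          gcongr
          exact hBW i
      _ = K * μ (W i) := by rw [hKc]; ring
  refine ⟨u, r, σ.restrict (⋃ i, V i)ᶜ, fun i => σ.restrict (V i),
    fun i => (σ (V i) / μ (W i)) • μ.restrict (W i), hcount, fun i hi => hrpos ⟨i, hi⟩,
    ?_, ?_, fun i => ?_, fun i => ?_, fun i => ?_, ?_⟩
  · rw [← Measure.restrict_iUnion hVdisj hVm,
      Measure.restrict_compl_add_restrict (MeasurableSet.iUnion hVm)]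
  -- On `S` outside the pieces no ball has density above `lam`, so the covering comparison applies.
  -- This part and the replacements each have density at most `K`, whence the factor `2`.
  · have hτ : ∀ s, MeasurableSet s → σ.restrict (⋃ i, V i)ᶜ s ≤ K * μ s := by
      intro s hs
      rw [Measure.restrict_apply hs]
      have hG := measure_le_of_subset_of_closedBall_le σ μ hn lam B R hR (S \ E)
        (fun x hx s hs => not_lt.1 fun hlt => hx.2 ⟨hx.1, s, hs, hlt⟩)
        (fun x hx => hB x hx.1) (s ∩ (⋃ i, V i)ᶜ ∩ S) (fun x hx => ⟨hx.2, fun hxE => hx.1.2 (by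
          rw [hVU, iUnion_coe_set]
          exact hcov hxE)⟩)
      rw [← hKc] at hG
      calc σ (s ∩ (⋃ i, V i)ᶜ) ≤ σ (s ∩ (⋃ i, V i)ᶜ ∩ S ∪ Sᶜ) := measure_mono fun x hx => by
            by_cases hxS : x ∈ S
            · exact Or.inl ⟨hx, hxS⟩
            · exact Or.inr hxS
        _ ≤ σ (s ∩ (⋃ i, V i)ᶜ ∩ S) + σ Sᶜ := measure_union_le _ _
        _ ≤ K * μ (s ∩ (⋃ i, V i)ᶜ ∩ S) := by rw [hσS, add_zero]; exact hG
        _ ≤ K * μ s := by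
            gcongr
            exact fun x hx => hx.1.1
    refine Measure.le_iff.2 fun s hs => ?_
    rw [Measure.add_apply, Measure.sum_apply _ hs, Measure.smul_apply, ENNReal.smul_def,
      smul_eq_mul, ENNReal.coe_mul, mul_assoc, ENNReal.coe_ofNat, two_mul]
    refine add_le_add (hτ s hs) ?_
    calc ∑' i, ((σ (V i) / μ (W i)) • μ.restrict (W i)) s
        ≤ ∑' i, K * μ.restrict (W i) s := by
          refine ENNReal.tsum_le_tsum fun i => ?_
          rw [Measure.smul_apply, smul_eq_mul]
          gcongr
          exact ENNReal.div_le_of_le_mul (hVK i)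
      _ = K * μ.restrict (⋃ i, W i) s := by
          rw [ENNReal.tsum_mul_left, Measure.restrict_iUnion hWdisj hWm, Measure.sum_apply _ hs]
      _ ≤ K * μ s := by
          gcongr
          exact Measure.restrict_le_self
  · rw [Measure.smul_apply, smul_eq_mul, Measure.restrict_apply_univ, Measure.restrict_apply_univ,
      ENNReal.div_mul_cancel (hW0 i) (measure_ne_top _ _)]
  · rw [Measure.restrict_apply measurableSet_closedBall.compl]
    exact measure_mono_null (fun x hx => hx.1 (hVsub i hx.2)) measure_empty
  · rw [Measure.smul_apply, Measure.restrict_apply measurableSet_closedBall.compl]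
    have h0 : (closedBall (i : X) (5 * r i))ᶜ ∩ W i = ∅ := by
      refine eq_empty_of_forall_notMem fun x hx => hx.1 ?_
      exact closedBall_subset_closedBall (by have := hrpos i; linarith) hx.2
    rw [h0, measure_empty, smul_zero]
  · rw [← ENNReal.tsum_mul_left]
    calc ∑' i : u, lam * ENNReal.ofReal (r i) ^ n ≤ ∑' i : u, σ (W i) :=
          ENNReal.tsum_le_tsum fun i => (hr i (huE i.2)).2.1.le
      _ = σ (⋃ i, W i) := (measure_iUnion hWdisj hWm).symm
      _ ≤ σ univ := measure_mono (subset_univ _)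

end Decomposition

/-! ### Weak type estimate for positive measures of small mass -/

section Weak

variable {d : ℕ}

local notation "𝔼" => EuclideanSpace ℝ (Fin d)

variable {n c η : ℝ} {k : EuclideanSpace ℝ (Fin d) → EuclideanSpace ℝ (Fin d) → ℂ}

/-- The oscillation of the truncated kernel `k(x, ·)` over a ball of radius `ρ` around `a`. -/
noncomputable def oscBound (n c η ε ρ : ℝ) (a x : 𝔼) : ℝ :=
  c * (ρ ^ η / dist x a ^ (n + η)) + (closedBall a (2 * ε)).indicator (fun _ => c / ε ^ n) x

theorem measurable_oscBound (n c η ε ρ : ℝ) (a : 𝔼) : Measurable (oscBound n c η ε ρ a) :=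
  (((measurable_const.div ((measurable_id.dist measurable_const).pow_const _))).const_mul _).add
    (measurable_const.indicator measurableSet_closedBall)

/-- The constant in the integral estimate for `oscBound`. -/
noncomputable def oscConst (n c η : ℝ) (A : ℝ≥0) : ℝ≥0 :=
  A * (Real.toNNReal c * dyadicConst n η + Real.toNNReal (c * 2 ^ n))

/-- The regularity term is summed dyadically; the truncation term is $c\,\varepsilon^{-n}$ on a ball
of `ν` measure $O(\varepsilon^n)$, so the bound depends on neither `ε` nor `ρ`. -/
theorem lintegral_oscBound_le (hn : 0 < n) (hc : 0 < c) (hη : 0 < η) {ν : Measure 𝔼} {A : ℝ≥0}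
    (hν : ∀ (x : 𝔼) (s : ℝ), 0 < s → ν (closedBall x s) ≤ A * ENNReal.ofReal s ^ n) {ε ρ : ℝ}
    (hε : 0 < ε) (hρ : 0 < ρ) (a : 𝔼) :
    ∫⁻ x in {x | ρ ≤ dist x a}, ENNReal.ofReal (oscBound n c η ε ρ a x) ∂ν ≤
      oscConst n c η A := by
  have hm1 : Measurable fun x : 𝔼 => ENNReal.ofReal c *
      ENNReal.ofReal (ρ ^ η / dist x a ^ (n + η)) :=
    (measurable_const.div ((measurable_id.dist measurable_const).pow_const _)).ennreal_ofReal.const_mul _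
  calc ∫⁻ x in {x | ρ ≤ dist x a}, ENNReal.ofReal (oscBound n c η ε ρ a x) ∂ν
      ≤ ∫⁻ x in {x | ρ ≤ dist x a}, (ENNReal.ofReal c *
          ENNReal.ofReal (ρ ^ η / dist x a ^ (n + η)) +
          (closedBall a (2 * ε)).indicator (fun _ => ENNReal.ofReal (c / ε ^ n)) x) ∂ν := by
        refine lintegral_mono fun x => ?_
        rw [oscBound]
        refine ENNReal.ofReal_add_le.trans (add_le_add ?_ ?_)
        · rw [ENNReal.ofReal_mul hc.le]
        · by_cases hx : x ∈ closedBall a (2 * ε)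
          · rw [indicator_of_mem hx, indicator_of_mem hx]
          · rw [indicator_of_notMem hx, indicator_of_notMem hx, ENNReal.ofReal_zero]
    _ = ENNReal.ofReal c * ∫⁻ x in {x | ρ ≤ dist x a},
          ENNReal.ofReal (ρ ^ η / dist x a ^ (n + η)) ∂ν +
        ∫⁻ x in {x | ρ ≤ dist x a},
          (closedBall a (2 * ε)).indicator (fun _ => ENNReal.ofReal (c / ε ^ n)) x ∂ν := by
        rw [lintegral_add_left hm1, lintegral_const_mul' _ _ ENNReal.ofReal_ne_top]
    _ ≤ ENNReal.ofReal c * (A * dyadicConst n η) +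
        ENNReal.ofReal (c / ε ^ n) * (A * ENNReal.ofReal (2 * ε) ^ n) := by
        refine add_le_add (mul_le_mul' le_rfl ?_) ?_
        · exact lintegral_rpow_div_le ν hn hη A a hρ fun s hs => hν a s (hρ.trans_le hs)
        · refine (setLIntegral_le_lintegral _ _).trans ?_
          rw [lintegral_indicator measurableSet_closedBall, setLIntegral_const]
          exact mul_le_mul' le_rfl (hν a _ (by positivity))
    _ = oscConst n c η A := by
        rw [oscConst, ENNReal.coe_mul, ENNReal.coe_add, mul_add, ENNReal.coe_mul,
          mul_left_comm, mul_left_comm (ENNReal.ofReal (c / ε ^ n)),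
          ENNReal.ofReal_rpow_of_pos (by positivity), ← ENNReal.ofReal_mul (by positivity),
          Real.mul_rpow (by norm_num) hε.le]
        congr 3
        have : 0 < ε ^ n := by positivity
        field_simp

theorem KernelBounds.hasSum_truncOp (hk : KernelBounds n c η k) (hn : 0 < n) {ε : ℝ} (hε : 0 < ε)
    {ι : Type*} (p : ι → Measure 𝔼) [IsFiniteMeasure (Measure.sum p)] (x : 𝔼) :
    HasSum (fun i => truncOp k ε (p i) x) (truncOp k ε (Measure.sum p) x) :=
  hasSum_integral_measure (hk.integrable_truncKernel hn hε x _)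

/-- Weak type estimate for a positive measure of small mass compared with the height. -/
theorem KernelBounds.measure_truncOp_le_of_small (hk : KernelBounds n c η k) (hn : 0 < n)
    {μ ν : Measure 𝔼} [IsFiniteMeasure μ] {S Z : Set 𝔼} (hS : IsCompact S) (hS0 : S.Nonempty)
    (hμS : μ Sᶜ = 0) (hνZ : ν Zᶜ = 0) {A A' B C : ℝ≥0} (hB1 : 1 ≤ B) {R : ℝ} (hR0 : 0 < R)
    (hR : ∀ x ∈ Z, ∀ y ∈ S, dist x y ≤ R)
    (hA : ∀ (x : 𝔼) (s : ℝ), 0 < s → μ (closedBall x s) ≤ A * ENNReal.ofReal s ^ n)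
    (hν : ∀ (x : 𝔼) (s : ℝ), 0 < s → ν (closedBall x s) ≤ A' * ENNReal.ofReal s ^ n)
    (hB : ∀ x ∈ S, ∀ s : ℝ, 0 < s → s ≤ R → ENNReal.ofReal s ^ n ≤ B * μ (closedBall x s))
    {ε : ℝ} (hε : 0 < ε)
    (hC : ∀ (Λ : ℝ≥0) (m : Measure 𝔼), m ≤ Λ • μ →
      ∫⁻ x, ‖truncOp k ε m x‖ₑ ^ 2 ∂μ ≤ C * (Λ * m univ))
    {lam : ℝ≥0} (hlam : 0 < lam) (σ : Measure 𝔼) [IsFiniteMeasure σ] (hσS : σ Sᶜ = 0)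
    (hσ : σ univ < lam * ENNReal.ofReal R ^ n) :
    ν {x | 2 * (goodConst n c η A B C * (2 * (lam * (5 : ℝ≥0) ^ n * B) : ℝ≥0)) <
        ‖truncOp k ε σ x‖ₑ} ≤
      (A' * (10 : ℝ≥0) ^ n + 9 * A' * (10 : ℝ≥0) ^ n * B * C + 2 * oscConst n c η A' : ℝ≥0) *
        σ univ / lam := by
  obtain ⟨u, r, τ, p, q, hu, hr, hσeq, hm, hpq, hp, hq, hsum⟩ :=
    exists_calderonZygmund_decomposition σ μ hn hσS hlam hR0 hB hσ
  have : Countable u := hu.to_subtype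
  set Λ : ℝ≥0 := 2 * (lam * (5 : ℝ≥0) ^ n * B) with hΛ
  set m := τ + Measure.sum q with hmdef
  set G := goodConst n c η A B C with hG
  have hG1 : 1 ≤ G := le_add_self
  have hlamΛ : lam ≤ Λ := by
    have h5 : (1 : ℝ≥0) ≤ (5 : ℝ≥0) ^ n := NNReal.one_le_rpow (by norm_num) hn.le
    calc lam = 1 * (lam * 1 * 1) := by ring
      _ ≤ Λ := by
        rw [hΛ]
        gcongr
        norm_num
  have hΛ0 : 0 < Λ := hlam.trans_le hlamΛ
  have hlam0 : (lam : ℝ≥0∞) ≠ 0 := by exact_mod_cast hlam.ne'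
  have : IsFiniteMeasure m := isFiniteMeasure_of_le_smul hm
  have : IsFiniteMeasure τ := isFiniteMeasure_of_le m (Measure.le_add_right le_rfl)
  have : IsFiniteMeasure (Measure.sum q) := isFiniteMeasure_of_le m (Measure.le_add_left le_rfl)
  have : IsFiniteMeasure (Measure.sum p) := isFiniteMeasure_of_le σ (by
    rw [hσeq]; exact Measure.le_add_left le_rfl)
  have hpfin : ∀ i, IsFiniteMeasure (p i) := fun i =>
    isFiniteMeasure_of_le (Measure.sum p) (Measure.le_sum p i)
  have hqfin : ∀ i, IsFiniteMeasure (q i) := fun i =>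
    isFiniteMeasure_of_le (Measure.sum q) (Measure.le_sum q i)
  have hpsum : ∑' i, p i univ ≤ σ univ := by
    rw [← Measure.sum_apply _ MeasurableSet.univ, hσeq, Measure.add_apply]
    exact le_add_self
  have hmσ : m univ = σ univ := by
    rw [hσeq, hmdef, Measure.add_apply, Measure.add_apply, Measure.sum_apply _ MeasurableSet.univ,
      Measure.sum_apply _ MeasurableSet.univ]
    simp_rw [hpq]
  -- Twice the balls of radius `5 * r i` carrying `p i` and `q i`, as the oscillation estimate
  -- demands.
  set U := ⋃ i : u, closedBall (i : 𝔼) (10 * r i) with hU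
  have hUm : MeasurableSet U := MeasurableSet.iUnion fun i => measurableSet_closedBall
  set g : 𝔼 → ℝ≥0∞ := fun x => ∑' i : u, 2 * p i univ *
    ENNReal.ofReal (oscBound n c η ε (5 * r i) (i : 𝔼) x) with hg
  have hosc : ∀ i : u, Measurable fun x : 𝔼 => 2 * p i univ *
      ENNReal.ofReal (oscBound n c η ε (5 * r i) (i : 𝔼) x) := fun i =>
    (measurable_oscBound n c η ε (5 * r i) (i : 𝔼)).ennreal_ofReal.const_mul _
  have hgm : Measurable g := Measurable.tsum hosc
  have hdiff : ∀ x ∉ U, ‖truncOp k ε σ x - truncOp k ε m x‖ₑ ≤ g x := by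
    intro x hx
    have hadd : ∀ (a b : Measure 𝔼) [IsFiniteMeasure a] [IsFiniteMeasure b],
        truncOp k ε (a + b) x = truncOp k ε a x + truncOp k ε b x := fun a b _ _ =>
      integral_add_measure (hk.integrable_truncKernel hn hε x a) (hk.integrable_truncKernel hn hε x b)
    have hs := (hk.hasSum_truncOp hn hε p x).sub (hk.hasSum_truncOp hn hε q x)
    have e : truncOp k ε σ x - truncOp k ε m x =
        ∑' i, (truncOp k ε (p i) x - truncOp k ε (q i) x) := by
      rw [hs.tsum_eq, hσeq, hmdef, hadd, hadd]
      ring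
    rw [e]
    refine enorm_tsum_le_tsum_enorm.trans (ENNReal.tsum_le_tsum fun i => ?_)
    have hxi : 2 * (5 * r i) ≤ dist x i := by
      by_contra! hlt
      exact hx (mem_iUnion.2 ⟨i, mem_closedBall.2 (by linarith)⟩)
    have hri := hr i i.2
    have hae : ∀ m' : Measure 𝔼, m' (closedBall (i : 𝔼) (5 * r i))ᶜ = 0 → ∀ᵐ y ∂m',
        ‖truncKernel k ε x y - truncKernel k ε x i‖ ≤ oscBound n c η ε (5 * r i) (i : 𝔼) x := by
      intro m' hm'
      have h0 : ∀ᵐ y ∂m', y ∈ closedBall (i : 𝔼) (5 * r i) := by rwa [ae_iff]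
      filter_upwards [h0] with y hy
      exact hk.norm_truncKernel_sub_le hn hε (by positivity) x y i hy hxi
    exact enorm_integral_sub_le_of_univ_eq (p i) (q i) (hpq i)
      (hk.integrable_truncKernel hn hε x _) (hk.integrable_truncKernel hn hε x _) _ _
      (hae _ (hp i)) (hae _ (hq i))
  -- Off `U`, either the bounded-density part or the difference accounts for half of the height; the
  -- difference is then treated by Chebyshev's inequality.
  have hsub : {x | 2 * (G * (Λ : ℝ≥0∞)) < ‖truncOp k ε σ x‖ₑ} ⊆
      (U ∪ {x | G * (Λ : ℝ≥0∞) < ‖truncOp k ε m x‖ₑ}) ∪ {x | G * (Λ : ℝ≥0∞) ≤ Uᶜ.indicator g x} := by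
    intro x hx
    by_cases hxU : x ∈ U
    · exact Or.inl (Or.inl hxU)
    by_cases hxm : G * (Λ : ℝ≥0∞) < ‖truncOp k ε m x‖ₑ
    · exact Or.inl (Or.inr hxm)
    refine Or.inr ?_
    show G * (Λ : ℝ≥0∞) ≤ Uᶜ.indicator g x
    rw [indicator_of_mem (show x ∈ Uᶜ from hxU)]
    by_contra! hlt
    have hx' : 2 * (G * (Λ : ℝ≥0∞)) < ‖truncOp k ε σ x‖ₑ := hx
    refine absurd hx' (not_lt.2 ?_)
    calc ‖truncOp k ε σ x‖ₑ = ‖truncOp k ε m x + (truncOp k ε σ x - truncOp k ε m x)‖ₑ := by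
          congr 1; ring
      _ ≤ G * Λ + G * Λ := (enorm_add_le _ _).trans
          (add_le_add (not_lt.1 hxm) ((hdiff x hxU).trans hlt.le))
      _ = 2 * (G * (Λ : ℝ≥0∞)) := by ring
  have h1 : ν U ≤ (A' * (10 : ℝ≥0) ^ n : ℝ≥0) * (σ univ / lam) := by
    calc ν U ≤ ∑' i : u, ν (closedBall (i : 𝔼) (10 * r i)) := measure_iUnion_le _
      _ ≤ ∑' i : u, (A' * (10 : ℝ≥0) ^ n : ℝ≥0) * ENNReal.ofReal (r i) ^ n := by
          refine ENNReal.tsum_le_tsum fun i => ?_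
          refine (hν i _ (by have := hr i i.2; positivity)).trans (le_of_eq ?_)
          rw [ofReal_mul_rpow (by norm_num) hn.le, ENNReal.coe_mul, coe_ofNat_rpow hn.le, mul_assoc]
          rfl
      _ ≤ _ := by
          rw [ENNReal.tsum_mul_left]
          gcongr
          rwa [ENNReal.le_div_iff_mul_le (Or.inl hlam0) (Or.inl ENNReal.coe_ne_top), mul_comm]
  have h2 : ν {x | G * (Λ : ℝ≥0∞) < ‖truncOp k ε m x‖ₑ} ≤
      (9 * A' * (10 : ℝ≥0) ^ n * B * C : ℝ≥0) * (σ univ / lam) := by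
    refine (hk.measure_truncOp_le_of_le_smul hn hS hS0 hμS hνZ hR hA hν hB hε hC hΛ0 hm).trans ?_
    rw [hmσ, mul_div_assoc]
    gcongr
  have h3 : ν {x | G * (Λ : ℝ≥0∞) ≤ Uᶜ.indicator g x} ≤
      (2 * oscConst n c η A' : ℝ≥0) * (σ univ / lam) := by
    have hint : ∫⁻ x, Uᶜ.indicator g x ∂ν ≤ (2 * oscConst n c η A' : ℝ≥0) * σ univ := by
      rw [lintegral_indicator hUm.compl, hg, lintegral_tsum fun i => (hosc i).aemeasurable]
      calc ∑' i : u, ∫⁻ x in Uᶜ, 2 * p i univ *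
              ENNReal.ofReal (oscBound n c η ε (5 * r i) (i : 𝔼) x) ∂ν
          ≤ ∑' i : u, 2 * p i univ * oscConst n c η A' := by
            refine ENNReal.tsum_le_tsum fun i => ?_
            have hri := hr i i.2
            rw [lintegral_const_mul' _ _ (by finiteness)]
            gcongr
            refine (lintegral_mono_set fun x hx => ?_).trans
              (lintegral_oscBound_le hn hk.c_pos hk.η_pos hν hε
                (by positivity : 0 < 5 * r i) (i : 𝔼))
            show 5 * r i ≤ dist x i
            by_contra! hlt
            exact hx (mem_iUnion.2 ⟨i, mem_closedBall.2 (by linarith)⟩)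
        _ = (2 * oscConst n c η A' : ℝ≥0) * ∑' i, p i univ := by
            rw [← ENNReal.tsum_mul_left]
            refine tsum_congr fun i => ?_
            push_cast
            ring
        _ ≤ _ := by gcongr
    have hGΛ0 : (G * (Λ : ℝ≥0∞)) ≠ 0 := by
      exact_mod_cast (mul_pos (zero_lt_one.trans_le hG1) hΛ0).ne'
    refine (meas_ge_le_lintegral_div (hgm.indicator hUm.compl).aemeasurable hGΛ0
      (by finiteness)).trans ?_
    rw [← mul_div_assoc]
    have : (lam : ℝ≥0∞) ≤ G * Λ := by
      exact_mod_cast hlamΛ.trans (le_mul_of_one_le_left zero_le hG1)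
    gcongr
  calc _ ≤ ν U + ν {x | G * (Λ : ℝ≥0∞) < ‖truncOp k ε m x‖ₑ} +
        ν {x | G * (Λ : ℝ≥0∞) ≤ Uᶜ.indicator g x} :=
        (measure_mono hsub).trans ((measure_union_le _ _).trans
          (add_le_add (measure_union_le _ _) le_rfl))
    _ ≤ _ := add_le_add (add_le_add h1 h2) h3
    _ = _ := by
        rw [mul_div_assoc, ENNReal.coe_add, ENNReal.coe_add]
        ring

end Weak

/-! ### Regularity constants and general positive measures -/

section Positive

variable {d : ℕ}

local notation "𝔼" => EuclideanSpace ℝ (Fin d)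

variable {n c η : ℝ} {k : EuclideanSpace ℝ (Fin d) → EuclideanSpace ℝ (Fin d) → ℂ}

theorem HasGrowth.exists_nnreal {ν : Measure 𝔼} (hν : HasGrowth n ν) :
    ∃ A : ℝ≥0, ∀ (x : 𝔼) (s : ℝ), 0 < s → ν (closedBall x s) ≤ A * ENNReal.ofReal s ^ n := by
  obtain ⟨c, hc, h⟩ := hν
  refine ⟨c.toNNReal, fun x s hs => (h x s hs).trans (le_of_eq ?_)⟩
  rw [ENNReal.ofReal_mul hc.le, ENNReal.ofReal_rpow_of_pos hs]
  rfl

theorem IsADRegular.exists_nnreal {μ : Measure 𝔼} (hμ : IsADRegular n μ)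
    (hμc : IsCompact μ.support) :
    ∃ A : ℝ≥0, ∀ x ∈ μ.support, ∀ s : ℝ, 0 < s → s ≤ diam μ.support →
      ENNReal.ofReal s ^ n ≤ A * μ (closedBall x s) ∧
        μ (closedBall x s) ≤ A * ENNReal.ofReal s ^ n := by
  obtain ⟨c, hc, h⟩ := hμ
  refine ⟨c.toNNReal, fun x hx s hs hsd => ?_⟩
  have hd : ENNReal.ofReal s ≤ ediam μ.support := by
    rw [← ENNReal.ofReal_toReal hμc.isBounded.ediam_ne_top]
    exact ENNReal.ofReal_le_ofReal hsd
  obtain ⟨h1, h2⟩ := h x hx s hs hd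
  have hsn : 0 < s ^ n := Real.rpow_pos_of_pos hs n
  rw [ENNReal.ofReal_rpow_of_pos hs]
  refine ⟨?_, h2.trans (le_of_eq (ENNReal.ofReal_mul hc.le))⟩
  calc ENNReal.ofReal (s ^ n) = ENNReal.ofReal c * ENNReal.ofReal (c⁻¹ * s ^ n) := by
        rw [← ENNReal.ofReal_mul hc.le]
        congr 1
        field_simp
    _ ≤ ENNReal.ofReal c * μ (closedBall x s) := by gcongr

/-- Beyond the diameter a ball centred on the support gains no mass. A ball of positive measure
centred elsewhere meets the support and lies in a ball of twice the radius centred there. -/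
theorem IsADRegular.exists_growth (hn : 0 < n) {μ : Measure 𝔼} (hμ : IsADRegular n μ)
    (hμc : IsCompact μ.support) (hd : 0 < diam μ.support) :
    ∃ A : ℝ≥0, ∀ (x : 𝔼) (s : ℝ), 0 < s → μ (closedBall x s) ≤ A * ENNReal.ofReal s ^ n := by
  obtain ⟨A, hA⟩ := hμ.exists_nnreal hμc
  have hS : ∀ x ∈ μ.support, ∀ s : ℝ, 0 < s → μ (closedBall x s) ≤ A * ENNReal.ofReal s ^ n := by
    intro x hx s hs
    rcases le_or_gt s (diam μ.support) with h | h
    · exact (hA x hx s hs h).2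
    · calc μ (closedBall x s) ≤ μ (closedBall x (diam μ.support) ∪ μ.supportᶜ) := by
            refine measure_mono fun y _ => ?_
            by_cases hy : y ∈ μ.support
            · exact Or.inl (dist_le_diam_of_mem hμc.isBounded hy hx)
            · exact Or.inr hy
        _ ≤ μ (closedBall x (diam μ.support)) + μ μ.supportᶜ := measure_union_le _ _
        _ ≤ A * ENNReal.ofReal (diam μ.support) ^ n := by
            rw [Measure.measure_compl_support, add_zero]
            exact (hA x hx _ hd le_rfl).2
        _ ≤ A * ENNReal.ofReal s ^ n := by gcongr
  refine ⟨A * (2 : ℝ≥0) ^ n, fun x s hs => ?_⟩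
  rcases eq_or_ne (μ (closedBall x s)) 0 with h0 | h0
  · rw [h0]
    exact zero_le
  · obtain ⟨z, hz, hzS⟩ := Measure.nonempty_inter_support_of_pos (pos_iff_ne_zero.2 h0)
    calc μ (closedBall x s) ≤ μ (closedBall z (2 * s)) := by
          refine measure_mono fun y hy => ?_
          rw [mem_closedBall] at hy hz ⊢
          have := dist_triangle_right y z x
          linarith
      _ ≤ A * ENNReal.ofReal (2 * s) ^ n := hS z hzS _ (by positivity)
      _ = _ := by
          rw [ofReal_mul_rpow (by norm_num) hn.le, ENNReal.coe_mul, coe_ofNat_rpow hn.le, mul_assoc]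
          rfl

/-- Scales between the diameter `D` and `R` cost only the factor $(R/D)^n$. The stopping balls and
the balls about nearest points may be of this size. -/
theorem IsADRegular.exists_lower (hn : 0 < n) {μ : Measure 𝔼} (hμ : IsADRegular n μ)
    (hμc : IsCompact μ.support) (hd : 0 < diam μ.support) {R : ℝ} (hR : 0 < R) :
    ∃ B : ℝ≥0, 1 ≤ B ∧ ∀ x ∈ μ.support, ∀ s : ℝ, 0 < s → s ≤ R →
      ENNReal.ofReal s ^ n ≤ B * μ (closedBall x s) := by
  obtain ⟨A, hA⟩ := hμ.exists_nnreal hμc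
  set D := diam μ.support with hD
  refine ⟨1 + A + (R / D).toNNReal ^ n * A, by rw [add_assoc]; exact le_self_add,
    fun x hx s hs hsR => ?_⟩
  rcases le_or_gt s D with h | h
  · refine (hA x hx s hs h).1.trans ?_
    gcongr
    exact le_add_self.trans le_self_add
  · calc ENNReal.ofReal s ^ n ≤ ENNReal.ofReal (R / D * D) ^ n := by
          gcongr
          rwa [div_mul_cancel₀ _ hd.ne']
      _ = ((R / D).toNNReal ^ n : ℝ≥0) * ENNReal.ofReal D ^ n := by
          rw [ofReal_mul_rpow (by positivity) hn.le, coe_ofNat_rpow hn.le,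
            Real.coe_toNNReal _ (by positivity)]
      _ ≤ ((R / D).toNNReal ^ n : ℝ≥0) * (A * μ (closedBall x D)) := by
          gcongr
          exact (hA x hx D hd le_rfl).1
      _ ≤ ((R / D).toNNReal ^ n : ℝ≥0) * (A * μ (closedBall x s)) := by
          gcongr
      _ ≤ _ := by
          rw [← mul_assoc, ← ENNReal.coe_mul]
          gcongr
          exact le_add_self

/-- For a point mass at `a` the size bound places the level set in a ball about `a` of radius
$(c\,\sigma(\mathbb R^d)/t)^{1/n}$. This covers supports of zero diameter, where regularity is
vacuous. -/
theorem KernelBounds.measure_truncOp_le_of_singleton (hk : KernelBounds n c η k) (hn : 0 < n)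
    {ν : Measure 𝔼} {A : ℝ≥0}
    (hν : ∀ (x : 𝔼) (s : ℝ), 0 < s → ν (closedBall x s) ≤ A * ENNReal.ofReal s ^ n) (a : 𝔼) {ε : ℝ}
    (hε : 0 < ε) (σ : Measure 𝔼) [IsFiniteMeasure σ] (hσ : σ {a}ᶜ = 0) {t : ℝ≥0} (ht : 0 < t) :
    ν {x | (t : ℝ≥0∞) < ‖truncOp k ε σ x‖ₑ} ≤ (A * c.toNNReal : ℝ≥0) * σ univ / t := by
  have hc := hk.c_pos
  have hae : ∀ᵐ y ∂σ, y = a := by rwa [ae_iff]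
  have hle : ∀ x, ‖truncOp k ε σ x‖ ≤ ‖truncKernel k ε x a‖ * σ.real univ := fun x =>
    norm_integral_le_of_norm_le_const (hae.mono fun y hy => by rw [hy])
  have hkey : ∀ x, (t : ℝ≥0∞) < ‖truncOp k ε σ x‖ₑ → 0 < dist x a ∧
      dist x a ^ n ≤ c * σ.real univ / t := by
    intro x hx
    have hx' : (t : ℝ) < ‖truncOp k ε σ x‖ := by
      rw [← ofReal_norm, ← ENNReal.ofReal_coe_nnreal] at hx
      exact (ENNReal.ofReal_lt_ofReal_iff_of_nonneg t.2).1 hx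
    have ht' : (0 : ℝ) < t := ht
    have h1 := hx'.trans_le (hle x)
    rcases le_or_gt (dist x a) ε with h | h
    · rw [truncKernel_of_le h, norm_zero, zero_mul] at h1
      linarith
    · have hd : 0 < dist x a := hε.trans h
      refine ⟨hd, ?_⟩
      rw [truncKernel_of_lt h] at h1
      have h2 := hk.size x a (dist_pos.1 hd)
      have hdn : 0 < dist x a ^ n := Real.rpow_pos_of_pos hd n
      rw [le_div_iff₀ ht']
      have h3 : (t : ℝ) < c / dist x a ^ n * σ.real univ :=
        h1.trans_le (mul_le_mul_of_nonneg_right h2 measureReal_nonneg)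
      rw [div_mul_eq_mul_div, lt_div_iff₀ hdn] at h3
      linarith
  set M := c * σ.real univ / t with hM
  have hM0 : 0 ≤ M := by positivity
  rcases hM0.eq_or_lt with h0 | h0
  · have hempty : {x | (t : ℝ≥0∞) < ‖truncOp k ε σ x‖ₑ} = ∅ := by
      refine eq_empty_of_forall_notMem fun x hx => ?_
      obtain ⟨h1, h2⟩ := hkey x hx
      exact absurd (Real.rpow_pos_of_pos h1 n) (not_lt.2 (h0 ▸ h2))
    rw [hempty, measure_empty]
    exact zero_le
  · have hs : 0 < M ^ n⁻¹ := Real.rpow_pos_of_pos h0 _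
    calc ν {x | (t : ℝ≥0∞) < ‖truncOp k ε σ x‖ₑ} ≤ ν (closedBall a (M ^ n⁻¹)) := by
          refine measure_mono fun x hx => ?_
          obtain ⟨h1, h2⟩ := hkey x hx
          rw [mem_closedBall, Real.le_rpow_inv_iff_of_pos h1.le hM0 hn]
          exact h2
      _ ≤ A * ENNReal.ofReal (M ^ n⁻¹) ^ n := hν a _ hs
      _ = _ := by
          rw [ENNReal.ofReal_rpow_of_pos hs, Real.rpow_inv_rpow hM0 hn.ne', hM,
            ENNReal.ofReal_div_of_pos (by exact_mod_cast ht), ENNReal.ofReal_mul hc.le,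
            ofReal_measureReal, ENNReal.ofReal_coe_nnreal, ENNReal.coe_mul]
          simp only [mul_div_assoc, mul_assoc]
          rfl

/-- The weak type estimate for positive measures on the support of `μ`. -/
theorem KernelBounds.exists_measure_truncOp_le (hk : KernelBounds n c η k) (hn : 0 < n)
    {μ ν : Measure 𝔼} [IsLocallyFiniteMeasure μ] [IsLocallyFiniteMeasure ν]
    (hμc : IsCompact μ.support) (hνc : IsCompact ν.support)
    (hμ : IsADRegular n μ) (hν : HasGrowth n ν) (hT : IsBoundedL2 k μ) :
    ∃ K : ℝ≥0, ∀ (ε : ℝ), 0 < ε → ∀ (σ : Measure 𝔼), IsFiniteMeasure σ → σ μ.supportᶜ = 0 →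
      ∀ t : ℝ≥0, 0 < t → ν {x | (t : ℝ≥0∞) < ‖truncOp k ε σ x‖ₑ} ≤ K * σ univ / t := by
  obtain ⟨A', hA'⟩ := hν.exists_nnreal
  rcases μ.support.subsingleton_or_nontrivial with hsub | hnt
  · obtain ⟨a, ha⟩ : ∃ a : 𝔼, μ.support ⊆ {a} := by
      rcases hsub.eq_empty_or_singleton with h | ⟨a, h⟩
      · exact ⟨0, by simp [h]⟩
      · exact ⟨a, h.subset⟩
    exact ⟨A' * c.toNNReal, fun ε hε σ _ hσ t ht => hk.measure_truncOp_le_of_singleton hn hA' a hε σ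
      (measure_mono_null (compl_subset_compl.2 ha) hσ) ht⟩
  have hd : 0 < diam μ.support := diam_pos hnt hμc.isBounded
  have hfinite : ∀ (m : Measure 𝔼) [IsLocallyFiniteMeasure m], IsCompact m.support →
      IsFiniteMeasure m := fun m _ hm => ⟨by
    calc m univ = m (m.support ∪ m.supportᶜ) := by rw [union_compl_self]
      _ ≤ m m.support + m m.supportᶜ := measure_union_le _ _
      _ < ∞ := by
        rw [Measure.measure_compl_support, add_zero]
        exact hm.measure_lt_top⟩
  have := hfinite μ hμc
  have := hfinite ν hνc
  obtain ⟨R₀, hR₀⟩ := isBounded_iff.1 (hνc.union hμc).isBounded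
  set R := max R₀ 1 with hRdef
  have hR0 : 0 < R := zero_lt_one.trans_le (le_max_right _ _)
  have hR : ∀ x ∈ ν.support, ∀ y ∈ μ.support, dist x y ≤ R := fun x hx y hy =>
    (hR₀ (Or.inl hx) (Or.inr hy)).trans (le_max_left _ _)
  obtain ⟨A, hA⟩ := hμ.exists_growth hn hμc hd
  obtain ⟨B, hB1, hB⟩ := hμ.exists_lower hn hμc hd hR0
  obtain ⟨C, hC⟩ := hT.exists_lintegral_truncOp_le
  set G := goodConst n c η A B C with hG
  -- The ratio of level to decomposition height: with `lam = t / κ` the threshold of the small-mass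
  -- estimate is exactly `t`.
  set κ : ℝ≥0 := 2 * (G * (2 * ((5 : ℝ≥0) ^ n * B))) with hκ
  have hκ0 : 0 < κ := by
    have h1 : 0 < G := zero_lt_one.trans_le le_add_self
    have h2 : 0 < B := zero_lt_one.trans_le hB1
    positivity
  set K₁ : ℝ≥0 :=
    A' * (10 : ℝ≥0) ^ n + 9 * A' * (10 : ℝ≥0) ^ n * B * C + 2 * oscConst n c η A' with hK₁
  refine ⟨(K₁ + (ν univ).toNNReal) * κ, fun ε hε σ hσfin hσ t ht => ?_⟩
  set lam := t / κ with hlam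
  have hlam0 : 0 < lam := by positivity
  have htlam : κ * lam = t := by rw [hlam]; field_simp
  have hdiv : ∀ z : ℝ≥0, (z : ℝ≥0∞) * σ univ / lam = (z * κ : ℝ≥0) * σ univ / t := by
    intro z
    have hκ' : (κ : ℝ≥0∞) ≠ 0 := by exact_mod_cast hκ0.ne'
    rw [← htlam, ENNReal.coe_mul z κ, ENNReal.coe_mul κ lam, mul_comm (z : ℝ≥0∞) κ, mul_assoc,
      ENNReal.mul_div_mul_left _ _ hκ' ENNReal.coe_ne_top]
  have hle : ∀ z : ℝ≥0, z ≤ K₁ + (ν univ).toNNReal → (z : ℝ≥0∞) * σ univ / lam ≤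
      ((K₁ + (ν univ).toNNReal) * κ : ℝ≥0) * σ univ / t := by
    intro z hz
    rw [hdiv]
    gcongr
  rcases lt_or_ge (σ univ) (lam * ENNReal.ofReal R ^ n) with hlt | hge
  · have h := hk.measure_truncOp_le_of_small hn hμc hnt.nonempty Measure.measure_compl_support
      Measure.measure_compl_support hB1 hR0 hR hA hA' hB hε (hC ε hε) hlam0 σ hσ hlt
    have e : (t : ℝ≥0∞) = 2 * (G * (2 * (lam * (5 : ℝ≥0) ^ n * B) : ℝ≥0)) := by
      rw [← htlam, hκ]
      push_cast
      ring
    rw [← e] at h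
    exact h.trans (hle _ le_self_add)
  -- For heavy `σ` the finite measure `ν univ` is itself an admissible bound; this uses `1 ≤ R`.
  · have h1 : (lam : ℝ≥0∞) ≤ σ univ := by
      refine le_trans ?_ hge
      refine le_mul_of_one_le_right zero_le ?_
      exact ENNReal.one_le_rpow (by
        rw [← ENNReal.ofReal_one]
        exact ENNReal.ofReal_le_ofReal (le_max_right _ _)) hn
    refine le_trans ?_ (hle _ le_add_self)
    rw [ENNReal.coe_toNNReal (measure_ne_top _ _), mul_div_assoc]
    calc _ ≤ ν univ := measure_mono (subset_univ _)
      _ = ν univ * 1 := (mul_one _).symm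
      _ ≤ ν univ * (σ univ / lam) := by
        gcongr
        rw [ENNReal.le_div_iff_mul_le (Or.inl (by exact_mod_cast hlam0.ne'))
          (Or.inl ENNReal.coe_ne_top), one_mul]
        exact h1

end Positive

/-! ### Integration against complex measures -/

section VectorIntegral

variable {X ι : Type*} [MeasurableSpace X] [Fintype ι]

/-- The integral with respect to a complex measure that is a combination of positive measures. -/
theorem integral_mul_eq_sum (σ : ComplexMeasure X) (p : ι → Measure X)
    [∀ j, IsFiniteMeasure (p j)] (w : ι → ℂ) (hw : ∀ j, ‖w j‖ ≤ 1)
    (hσ : ∀ s, MeasurableSet s → σ s = ∑ j, w j * (p j).real s) (f : X → ℂ)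
    (hf : Integrable f (∑ j, p j)) :
    ∫ᵛ x, f x ∂[ContinuousLinearMap.mul ℝ ℂ; σ] = ∑ j, w j * ∫ x, f x ∂(p j) := by
  -- The positive measure `P` dominates the variation of `σ` and every `p j`, so both sides are
  -- continuous functionals on $L^1(P)$ and need only be compared on indicators.
  set P := ∑ j, p j with hP
  have hpP : ∀ j, p j ≤ (1 : ℝ≥0∞) • P := fun j => by
    rw [one_smul]
    refine Measure.le_iff.2 fun s _ => ?_
    rw [hP, Measure.finsetSum_apply]
    exact Finset.single_le_sum (f := fun j => p j s) (fun _ _ => zero_le) (Finset.mem_univ j)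
  have hvar : σ.variation ≤ (1 : ℝ≥0∞) • P := by
    rw [one_smul]
    refine VectorMeasure.variation_le_of_forall_enorm_le fun s hs => ?_
    rw [hσ s hs, hP, Measure.finsetSum_apply]
    refine (enorm_sum_le _ _).trans (Finset.sum_le_sum fun j _ => ?_)
    rw [← ofReal_norm, ← ofReal_measureReal, norm_mul, Complex.norm_real,
      Real.norm_of_nonneg measureReal_nonneg]
    exact ENNReal.ofReal_le_ofReal (mul_le_of_le_one_left measureReal_nonneg (hw j))
  have hdom := dominatedFinMeasAdditive_cbmApplyMeasure σ (ContinuousLinearMap.mul ℝ ℂ)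
  have hdomP := DominatedFinMeasAdditive.of_measure_le_smul ENNReal.one_ne_top hvar hdom
    (by positivity)
  rw [VectorMeasure.integral_eq_setToFun,
    ← setToFun_congr_measure_of_integrable 1 (by simp) hvar hdomP hdom f hf]
  have hint : ∀ {g : X → ℂ} (j : ι), Integrable g P → Integrable g (p j) := fun j hg =>
    hg.of_measure_le_smul (by simp) (hpP j)
  refine Integrable.induction (μ := P) (fun g => setToFun P (σ.transpose
    (ContinuousLinearMap.mul ℝ ℂ)) hdomP g = ∑ j, w j * ∫ x, g x ∂(p j)) ?_ ?_ ?_ ?_ hf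
  · intro z s hs _
    rw [setToFun_indicator_const hdomP hs (by finiteness)]
    have : σ.transpose (ContinuousLinearMap.mul ℝ ℂ) s z = z * σ s := rfl
    rw [this, hσ s hs, Finset.mul_sum]
    refine Finset.sum_congr rfl fun j _ => ?_
    rw [integral_indicator_const _ hs, Complex.real_smul]
    ring
  · intro g h _ hg hh hge hhe
    rw [setToFun_add hdomP hg hh, hge, hhe, ← Finset.sum_add_distrib]
    refine Finset.sum_congr rfl fun j _ => ?_
    rw [← mul_add, ← integral_add (hint j hg) (hint j hh)]
    rfl
  · refine isClosed_eq (continuous_setToFun hdomP)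
      (continuous_finsetSum _ fun j _ => continuous_const.mul ?_)
    have := continuous_integral.comp (continuous_L1_toL1 (G := ℂ) 1 (by simp) (hpP j))
    refine this.congr fun g => ?_
    exact integral_congr_ae (Integrable.coeFn_toL1 _)
  · intro g h hgh _ hg
    rw [← setToFun_congr_ae hdomP hgh, hg]
    refine Finset.sum_congr rfl fun j _ => ?_
    congr 1
    refine integral_congr_ae ?_
    exact (Measure.absolutelyContinuous_of_le_smul (hpP j)).ae_le hgh

end VectorIntegral

/-! ### Splitting into four positive parts -/

section Main

variable {d : ℕ}

local notation "𝔼" => EuclideanSpace ℝ (Fin d)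

variable {n c η : ℝ} {k : EuclideanSpace ℝ (Fin d) → EuclideanSpace ℝ (Fin d) → ℂ}

/-- If the sum exceeds `t`, one of the four terms exceeds `t / 4`. Four level sets at a quarter of
the height give the factor `16`. -/
theorem measure_lt_enorm_sum_le {X : Type*} [MeasurableSpace X] (ν : Measure X)
    (F : Fin 4 → X → ℂ) (w : Fin 4 → ℂ) (hw : ∀ j, ‖w j‖ ≤ 1) (b : ℝ≥0∞)
    (h : ∀ j, ∀ t : ℝ≥0, 0 < t → ν {x | (t : ℝ≥0∞) < ‖F j x‖ₑ} ≤ b / t) {t : ℝ} (ht : 0 < t) :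
    ν {x | t < ‖∑ j, w j * F j x‖} ≤ 16 * b / ENNReal.ofReal t := by
  set s : ℝ≥0 := t.toNNReal / 4 with hs
  have hs0 : 0 < s := by positivity
  have hst : ENNReal.ofReal t = 4 * s := by
    have : t.toNNReal = 4 * s := by rw [hs]; field_simp
    rw [ENNReal.ofReal, this, ENNReal.coe_mul]
    rfl
  have hsub : {x | t < ‖∑ j, w j * F j x‖} ⊆ ⋃ j, {x | (s : ℝ≥0∞) < ‖F j x‖ₑ} := by
    intro x hx
    by_contra hcon
    rw [mem_iUnion, not_exists] at hcon
    have hx' : t < ‖∑ j, w j * F j x‖ := hx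
    have h1 : ENNReal.ofReal t < ‖∑ j, w j * F j x‖ₑ := by
      rw [← ofReal_norm]
      exact (ENNReal.ofReal_lt_ofReal_iff_of_nonneg ht.le).2 hx'
    refine absurd h1 (not_lt.2 ?_)
    calc ‖∑ j, w j * F j x‖ₑ ≤ ∑ j, ‖w j * F j x‖ₑ := enorm_sum_le _ _
      _ ≤ ∑ _j : Fin 4, (s : ℝ≥0∞) := by
        refine Finset.sum_le_sum fun j _ => ?_
        refine le_trans ?_ (not_lt.1 (hcon j))
        rw [← ofReal_norm, ← ofReal_norm, norm_mul]
        exact ENNReal.ofReal_le_ofReal (mul_le_of_le_one_left (norm_nonneg _) (hw j))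
      _ = ENNReal.ofReal t := by
        rw [hst, Finset.sum_const, Finset.card_univ, Fintype.card_fin, nsmul_eq_mul]
        rfl
  calc ν {x | t < ‖∑ j, w j * F j x‖} ≤ ∑' j, ν {x | (s : ℝ≥0∞) < ‖F j x‖ₑ} :=
        (measure_mono hsub).trans (measure_iUnion_le _)
    _ ≤ ∑' _j : Fin 4, b / s := ENNReal.tsum_le_tsum fun j => h j s hs0
    _ = 4 * (b / s) := by
        rw [tsum_fintype, Finset.sum_const, Finset.card_univ, Fintype.card_fin, nsmul_eq_mul]
        rfl
    _ = 16 * b / ENNReal.ofReal t := by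
        rw [hst, show (16 : ℝ≥0∞) * b = 4 * (4 * b) by ring,
          ENNReal.mul_div_mul_left _ _ (by norm_num) (by norm_num), mul_div_assoc]

/-- The coefficients of the real and imaginary positive and negative parts. -/
noncomputable def partCoeff : Fin 4 → ℂ := ![1, -1, Complex.I, -Complex.I]

theorem norm_partCoeff_le (j : Fin 4) : ‖partCoeff j‖ ≤ 1 := by
  fin_cases j <;> simp [partCoeff]

/-- Jordan parts of the real and imaginary parts. Domination by the variation gives both the mass
bound and concentration on the support. -/
theorem exists_complexMeasure_eq_sum {X : Type*} [MeasurableSpace X] (σ : ComplexMeasure X) :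
    ∃ p : Fin 4 → Measure X, (∀ j, IsFiniteMeasure (p j)) ∧ (∀ j, p j ≤ σ.variation) ∧
      ∀ s, MeasurableSet s → σ s = ∑ j, partCoeff j * (p j).real s := by
  set a := ComplexMeasure.re σ with ha
  set b := ComplexMeasure.im σ with hb
  have hav : a.totalVariation ≤ σ.variation := by
    rw [SignedMeasure.totalVariation_eq_variation]
    refine VectorMeasure.variation_le_of_forall_enorm_le fun s _ => ?_
    refine le_trans ?_ (VectorMeasure.enorm_measure_le_variation σ s)
    rw [← ofReal_norm, ← ofReal_norm]
    exact ENNReal.ofReal_le_ofReal (Complex.abs_re_le_norm _)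
  have hbv : b.totalVariation ≤ σ.variation := by
    rw [SignedMeasure.totalVariation_eq_variation]
    refine VectorMeasure.variation_le_of_forall_enorm_le fun s _ => ?_
    refine le_trans ?_ (VectorMeasure.enorm_measure_le_variation σ s)
    rw [← ofReal_norm, ← ofReal_norm]
    exact ENNReal.ofReal_le_ofReal (Complex.abs_im_le_norm _)
  have h1 : ∀ s : SignedMeasure X, s.toJordanDecomposition.posPart ≤ s.totalVariation := fun s =>
    Measure.le_add_right le_rfl
  have h2 : ∀ s : SignedMeasure X, s.toJordanDecomposition.negPart ≤ s.totalVariation := fun s =>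
    Measure.le_add_left le_rfl
  refine ⟨![a.toJordanDecomposition.posPart, a.toJordanDecomposition.negPart,
    b.toJordanDecomposition.posPart, b.toJordanDecomposition.negPart], ?_, ?_, ?_⟩
  · intro j
    fin_cases j
    · exact a.toJordanDecomposition.posPart_finite
    · exact a.toJordanDecomposition.negPart_finite
    · exact b.toJordanDecomposition.posPart_finite
    · exact b.toJordanDecomposition.negPart_finite
  · intro j
    fin_cases j
    · exact (h1 a).trans hav
    · exact (h2 a).trans hav
    · exact (h1 b).trans hbv
    · exact (h2 b).trans hbv
  · intro s hs
    have e1 : (σ s).re = a s := rfl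
    have e2 : (σ s).im = b s := rfl
    rw [Fin.sum_univ_four, ← Complex.re_add_im (σ s), e1, e2,
      a.apply_eq_posPart_real_sub_negPart_real hs, b.apply_eq_posPart_real_sub_negPart_real hs]
    simp only [partCoeff, Matrix.cons_val]
    push_cast
    ring

/-- The densities are the positive parts of $\pm\operatorname{Re}f$ and $\pm\operatorname{Im}f$.
Absolute continuity is recorded so that the parts vanish off the support of `μ`. -/
theorem truncFun_eq_sum (hk : KernelBounds n c η k) (hn : 0 < n) (μ : Measure 𝔼) {ε : ℝ}
    (hε : 0 < ε) (f : 𝔼 → ℂ) (hf : MemLp f 1 μ) :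
    ∃ p : Fin 4 → Measure 𝔼, (∀ j, IsFiniteMeasure (p j)) ∧ (∀ j, p j ≪ μ) ∧
      (∀ j, p j univ ≤ eLpNorm f 1 μ) ∧
      ∀ x, truncFun k μ ε f x = ∑ j, partCoeff j * truncOp k ε (p j) x := by
  have hfi : Integrable f μ := memLp_one_iff_integrable.1 hf
  set g : Fin 4 → 𝔼 → ℝ := ![fun x => (f x).re, fun x => -(f x).re, fun x => (f x).im,
    fun x => -(f x).im] with hg
  have hgi : ∀ j, Integrable (g j) μ := by
    intro j
    fin_cases j
    · exact hfi.re
    · exact hfi.re.neg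
    · exact hfi.im
    · exact hfi.im.neg
  have hgf : ∀ j x, g j x ≤ ‖f x‖ := by
    intro j x
    fin_cases j
    · exact (le_abs_self _).trans (Complex.abs_re_le_norm _)
    · exact (neg_le_abs _).trans (Complex.abs_re_le_norm _)
    · exact (le_abs_self _).trans (Complex.abs_im_le_norm _)
    · exact (neg_le_abs _).trans (Complex.abs_im_le_norm _)
  have hmass : ∀ j, μ.withDensity (fun x => ENNReal.ofReal (g j x)) univ ≤ eLpNorm f 1 μ := by
    intro j
    rw [withDensity_apply _ MeasurableSet.univ, Measure.restrict_univ, eLpNorm_one_eq_lintegral_enorm]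
    refine lintegral_mono fun x => ?_
    rw [← ofReal_norm]
    exact ENNReal.ofReal_le_ofReal (hgf j x)
  have hfin : ∀ j, IsFiniteMeasure (μ.withDensity fun x => ENNReal.ofReal (g j x)) := fun j =>
    ⟨(hmass j).trans_lt hf.2⟩
  refine ⟨fun j => μ.withDensity fun x => ENNReal.ofReal (g j x), hfin,
    fun j => withDensity_absolutelyContinuous _ _, hmass, fun x => ?_⟩
  have hop : ∀ j, truncOp k ε (μ.withDensity fun x => ENNReal.ofReal (g j x)) x =
      ∫ y, (ENNReal.ofReal (g j y)).toReal • truncKernel k ε x y ∂μ := fun j =>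
    integral_withDensity_eq_integral_toReal_smul₀ (hgi j).aemeasurable.ennreal_ofReal
      (Filter.Eventually.of_forall fun _ => ENNReal.ofReal_lt_top) _
  have hint : ∀ j, Integrable (fun y => (ENNReal.ofReal (g j y)).toReal • truncKernel k ε x y) μ :=
    fun j => (integrable_withDensity_iff_integrable_smul₀' (hgi j).aemeasurable.ennreal_ofReal
      (Filter.Eventually.of_forall fun _ => ENNReal.ofReal_lt_top)).1
      (hk.integrable_truncKernel hn hε x _)
  simp_rw [hop, ← integral_const_mul]
  rw [truncFun_eq_integral, ← integral_finsetSum _ fun j _ => (hint j).const_mul _]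
  refine integral_congr_ae (Filter.Eventually.of_forall fun y => ?_)
  have hpart : ∀ a : ℝ, (((ENNReal.ofReal a).toReal : ℝ) : ℂ) -
      (((ENNReal.ofReal (-a)).toReal : ℝ) : ℂ) = a := by
    intro a
    rw [ENNReal.toReal_ofReal', ENNReal.toReal_ofReal', ← Complex.ofReal_sub]
    congr 1
    rcases le_total a 0 with h | h
    · rw [max_eq_right h, max_eq_left (by linarith)]; ring
    · rw [max_eq_left h, max_eq_right (by linarith)]; ring
  simp only [Fin.sum_univ_four, hg, partCoeff, Matrix.cons_val, Complex.real_smul]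
  linear_combination -truncKernel k ε x y * Complex.re_add_im (f y) -
    truncKernel k ε x y * hpart (f y).re - truncKernel k ε x y * Complex.I * hpart (f y).im

end Main

end CZ

theorem theorem1p3 {d : ℕ} (n : ℝ) (hn : 0 < n)
    (μ ν : Measure (EuclideanSpace ℝ (Fin d)))
    [IsLocallyFiniteMeasure μ] [IsLocallyFiniteMeasure ν]
    (hμc : IsCompact μ.support) (hνc : IsCompact ν.support)
    (hμ : CZ.IsADRegular n μ) (hν : CZ.HasGrowth n ν)
    (k : EuclideanSpace ℝ (Fin d) → EuclideanSpace ℝ (Fin d) → ℂ)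
    (hk : CZ.IsCZKernel n k) (hT : CZ.IsBoundedL2 k μ) :
    CZ.IsBoundedMeasureWeakL1 k μ.support ν ∧ CZ.IsBoundedL1WeakL1 k μ ν := by
  obtain ⟨c, η, hk⟩ := hk.exists_kernelBounds
  obtain ⟨K, hK⟩ := hk.exists_measure_truncOp_le hn hμc hνc hμ hν hT
  refine ⟨⟨16 * K, fun ε hε σ hσ t ht => ?_⟩, ⟨16 * K, fun ε hε f hf t ht => ?_⟩⟩
  · obtain ⟨p, hp, hpσ, hsum⟩ := CZ.exists_complexMeasure_eq_sum σ
    have hσ' : σ.variation μ.supportᶜ = 0 := hσ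
    have hT' : ∀ x, CZ.truncMeasure k ε σ x = ∑ j, CZ.partCoeff j * CZ.truncOp k ε (p j) x := by
      intro x
      rw [CZ.truncMeasure, ← VectorMeasure.integral_indicator (CZ.measurableSet_lt_dist ε x)]
      exact CZ.integral_mul_eq_sum σ p _ CZ.norm_partCoeff_le hsum _
        (hk.integrable_truncKernel hn hε x _)
    have huniv : ∀ j, p j Set.univ ≤ σ.variation μ.support := fun j => by
      calc p j Set.univ ≤ σ.variation (μ.support ∪ μ.supportᶜ) := by
            rw [Set.union_compl_self]
            exact hpσ j _
        _ ≤ σ.variation μ.support + σ.variation μ.supportᶜ := measure_union_le _ _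
        _ = σ.variation μ.support := by rw [hσ', add_zero]
    simp_rw [hT']
    refine (CZ.measure_lt_enorm_sum_le ν (fun j => CZ.truncOp k ε (p j)) _ CZ.norm_partCoeff_le
      (K * σ.variation μ.support) (fun j s hs => ?_) ht).trans (le_of_eq ?_)
    · refine (hK ε hε (p j) (hp j) (le_antisymm ((hpσ j _).trans hσ'.le) zero_le) s hs).trans ?_
      exact ENNReal.div_le_div_right (mul_le_mul' le_rfl (huniv j)) _
    · rw [ENNReal.coe_mul, mul_assoc]
      rfl
  · obtain ⟨p, hp, hpμ, huniv, hT'⟩ := CZ.truncFun_eq_sum hk hn μ hε f hf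
    simp_rw [hT']
    refine (CZ.measure_lt_enorm_sum_le ν (fun j => CZ.truncOp k ε (p j)) _ CZ.norm_partCoeff_le
      (K * eLpNorm f 1 μ) (fun j s hs => ?_) ht).trans (le_of_eq ?_)
    · refine (hK ε hε (p j) (hp j) (hpμ j Measure.measure_compl_support) s hs).trans ?_
      exact ENNReal.div_le_div_right (mul_le_mul' le_rfl (huniv j)) _
    · rw [ENNReal.coe_mul, mul_assoc]
      rfl
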